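/- **Setting.** Let $A$ be a finite alphabet and $X\subseteq A^{\mathbb Z}$ an infinite synchronizing subshift: $X$ is closed, $\sigma(X)=X$, $X$ is transitive, and its language $L(X)$ contains a synchronizing word, i.e. a word $w$ such that $uw,wv\in L(X)$ implies $uwv\in L(X)$. $\mathrm{Aut}(X)$ is the group of reversible cellular automata on $X$ (the self-homeomorphisms of $X$ commuting with $\sigma$), and $C(S)$ is the centralizer of $S\subseteq\mathrm{Aut}(X)$ in $\mathrm{Aut}(X)$. Let $\mathbf 0,\mathbf 1\in L(X)$ be words, $\mathbf 0$ nonempty, $|\mathbf 1|\ge 2$, and put $p=|\mathbf 0|$, $q=|\mathbf 1|$, $K=\gcd(p,q)$. Assume (as may be arranged on any infinite synchronizing subshift by passing to a conjugate one): $\mathbf 0^{\mathbb Z}\in X$; $\mathbf 0$ is synchronizing, all its letters are distinct, each of them but the last has a unique successor letter in $X$ and each of them but the first a unique predecessor letter; no letter of $\mathbf 0$ occurs in $\mathbf 1$; $\mathbf 0\mathbf 1^k\mathbf 0\in L(X)$ for all $k\ge 0$; $q\equiv K \pmod p$; and $K$ divides $|w|$ whenever $w,\mathbf 0w\mathbf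 0\in L(X)$. Below, "replaces" refers to the simultaneous replacement of all occurrences in a configuration. $P_1$ exchanges $\mathbf 0\mathbf 0^q\mathbf 1\mathbf 0$ and $\mathbf 0\mathbf 1^{p+1}\mathbf 0$; $P_2$ exchanges $\mathbf 0\mathbf 1^{p+1}\mathbf 0$ and $\mathbf 0\mathbf 1\mathbf 0^q\mathbf 0$. For $n>n_0:=|\mathbf 1^{p+1+p/K}|$ and $1\le j\le p/K$ let $u_j'=\mathbf 1\mathbf 0^q\mathbf 1^j$ and let $u'_{j,1},\dots,u'_{j,n_j}=\mathbf 1^{p+1+j}$ be an enumeration without repetitions of all nonempty words $w$ of length at most $n-1$ containing no letter of $\mathbf 0$, with $\mathbf 0w\mathbf 0\in L(X)$ and $|w|\equiv(j+1)K\pmod p$, where for $j=p/K$ the words $\mathbf 1$ and $\mathbf 1^{p+1}$ are left out. Choose exponents $c_j,c_{j,i}\ge q+1$ such that, for each fixed $j$, the words $u_j=\mathbf 0^{c_j}u_j'$ and $u_{j,i}=\mathbf 0^{c_{j,i}}u'_{j,i}$ all have the same length. $P_{4,n}$ replaces, for every $j$, the words $u_j\mathbf 0\to u_{j,1}\mathbf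 0\to\dots\to u_{j,n_j}\mathbf 0\to u_j\mathbf 0$ cyclically. Put $G_{X,n}=P_{4,n}\circ P_2\circ P_1$. With $\overleftarrow g=\mathbf 0^q\mathbf 1$ and $\overrightarrow g=\mathbf 1^{p+1}$, let $F_1$ exchange $\mathbf 0\overrightarrow g\mathbf 0\mathbf 0\mathbf 0\overleftarrow g\mathbf 0$ and $\mathbf 0\overrightarrow g\mathbf 0\mathbf 0\overleftarrow g\mathbf 0\mathbf 0$, let $F_2$ exchange $\mathbf 0\overrightarrow g\mathbf 0\mathbf 0\overleftarrow g\mathbf 0$ and $\mathbf 0\mathbf 0\overrightarrow g\mathbf 0\overleftarrow g\mathbf 0$, and put $F=F_2\circ F_1$. **Statement.** For all such $X,\mathbf 0,\mathbf 1$ and all choices made for each $n>n_0$: 1. $F$ and all $G_{X,n}$ with $n>n_0$ are automorphisms of $X$. 2. If $S$ is any finite subset of the subgroup of $\mathrm{Aut}(X)$ generated by $\{G_{X,n}\mid n>n_0\}\cup\{F\}$, then $C(S)\supsetneq\langle\sigma\rangle$. 3. A subset $R\subseteq\mathrm{Aut}(X)$ with $C(R)=\langle\sigma\rangle$ need not have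 a finite subset with the same centralizer: there is $R\subseteq\mathrm{Aut}(X)$ with $C(R)=\langle\sigma\rangle$ such that $C(S)\ne\langle\sigma\rangle$ for every finite $S\subseteq R$. -/

import Mathlib

namespace SymbolicDynamics

/-- The word `w` occurs in the configuration `x` at position `i`. -/
def OccursAt {A : Type*} (x : ℤ → A) (w : List A) (i : ℤ) : Prop :=
  ∀ (k : ℕ) (hk : k < w.length), x (i + k) = w[k]

/-- The power `w ^ k` of a word. -/
def wpow {A : Type*} (w : List A) (k : ℕ) : List A :=
  (List.replicate k w).flatten

/-- The shift map on `A ^ ℤ`. -/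
def shiftMap {A : Type*} (x : ℤ → A) : ℤ → A := fun i => x (i + 1)

/-- A subshift: a closed set of configurations (for the product topology) with `σ(X) = X`. -/
structure Subshift (A : Type*) [TopologicalSpace A] where
  carrier : Set (ℤ → A)
  isClosed : IsClosed carrier
  shift_image : shiftMap '' carrier = carrier

namespace Subshift

variable {A : Type*} [TopologicalSpace A]

theorem shift_mem (X : Subshift A) {x : ℤ → A} (hx : x ∈ X.carrier) :
    shiftMap x ∈ X.carrier := by
  rw [← X.shift_image]
  exact ⟨x, hx, rfl⟩

theorem unshift_mem (X : Subshift A) {x : ℤ → A} (hx : x ∈ X.carrier) :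
    (fun i => x (i - 1)) ∈ X.carrier := by
  rw [← X.shift_image] at hx
  obtain ⟨y, hy, rfl⟩ := hx
  simpa [shiftMap] using hy

/-- The shift `σ` as a self-homeomorphism of `X`. -/
def shiftHomeo (X : Subshift A) : X.carrier ≃ₜ X.carrier where
  toFun x := ⟨shiftMap x.1, X.shift_mem x.2⟩
  invFun x := ⟨fun i => x.1 (i - 1), X.unshift_mem x.2⟩
  left_inv x := by
    apply Subtype.ext
    funext i
    simp [shiftMap]
  right_inv x := by
    apply Subtype.ext
    funext i
    simp [shiftMap]
  continuous_toFun := by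
    refine Continuous.subtype_mk ?_ _
    exact continuous_pi fun i => (continuous_apply (i + 1)).comp continuous_subtype_val
  continuous_invFun := by
    refine Continuous.subtype_mk ?_ _
    exact continuous_pi fun i => (continuous_apply (i - 1)).comp continuous_subtype_val

/-- `Aut(X)`: the group (under composition) of all self-homeomorphisms of `X` that commute with
the shift, that is, of all reversible cellular automata on `X`. -/
def Aut (X : Subshift A) : Subgroup (X.carrier ≃ₜ X.carrier) :=
  Subgroup.centralizer {X.shiftHomeo}

/-- The shift `σ` as an element of `Aut(X)`. -/
def σ (X : Subshift A) : X.Aut :=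
  ⟨X.shiftHomeo, Subgroup.mem_centralizer_singleton_iff.mpr rfl⟩

/-- The map `f` on configurations restricts to the automorphism `g` of `X`. -/
def Restricts (X : Subshift A) (f : (ℤ → A) → (ℤ → A)) (g : X.Aut) : Prop :=
  ∀ x : X.carrier, ((g : X.carrier ≃ₜ X.carrier) x : ℤ → A) = f x

/-- The language `L(X)`. -/
def language (X : Subshift A) : Set (List A) :=
  {w | ∃ x ∈ X.carrier, ∃ i : ℤ, OccursAt x w i}

def IsTransitive (X : Subshift A) : Prop :=
  ∀ u ∈ X.language, ∀ v ∈ X.language, ∃ w ∈ X.language, u ++ w ++ v ∈ X.language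

def IsSynchronizingWord (X : Subshift A) (w : List A) : Prop :=
  w ∈ X.language ∧ ∀ u ∈ X.language, ∀ v ∈ X.language,
    u ++ w ∈ X.language → w ++ v ∈ X.language → u ++ w ++ v ∈ X.language

/-- Synchronizing subshifts: transitive, with a synchronizing word. -/
def IsSynchronizing (X : Subshift A) : Prop :=
  X.IsTransitive ∧ ∃ w, X.IsSynchronizingWord w

/-- A word `w ∈ L(X)` with distinct letters is deterministic: each of its letters but the last
has a unique successor in `X`, and each of its letters but the first a unique predecessor. -/
def IsDeterministic (X : Subshift A) (w : List A) : Prop :=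
  w ∈ X.language ∧ w.Nodup ∧
  (∀ (i : ℕ) (hi : i + 1 < w.length), ∃! a : A, [w[i], a] ∈ X.language) ∧
  (∀ (i : ℕ) (hi : i + 1 < w.length), ∃! a : A, [a, w[i + 1]] ∈ X.language)

/-- The standing assumptions on the marker words `z` (bold zero) and `o` (bold one). -/
structure IsMarkerPair (X : Subshift A) (z o : List A) : Prop where
  z_ne_nil : z ≠ []
  o_mem : o ∈ X.language
  two_le_length : 2 ≤ o.length
  /-- the periodic configuration `z ^ ℤ` belongs to `X` -/
  z_periodic : ∃ x ∈ X.carrier, ∀ i : ℤ, OccursAt x z (i * z.length)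
  z_deterministic : X.IsDeterministic z
  z_synchronizing : X.IsSynchronizingWord z
  not_mem_o : ∀ a ∈ z, a ∉ o
  z_pow_z_mem : ∀ k : ℕ, z ++ wpow o k ++ z ∈ X.language
  length_modEq : o.length ≡ Nat.gcd z.length o.length [MOD z.length]
  gcd_dvd : ∀ w ∈ X.language, z ++ w ++ z ∈ X.language → Nat.gcd z.length o.length ∣ w.length

end Subshift

/-- `y` is obtained from `x` by replacing, simultaneously, every occurrence in `x` of the first
word of a pair in `R` by the second word of that pair, and changing nothing else. -/
def IsReplacement {A : Type*} (R : Set (List A × List A)) (x y : ℤ → A) : Prop :=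
  (∀ r ∈ R, ∀ k : ℤ, OccursAt x r.1 k → OccursAt y r.2 k) ∧
  (∀ i : ℤ, (∀ r ∈ R, ∀ k : ℤ, OccursAt x r.1 k → ¬ (k ≤ i ∧ i < k + r.1.length)) → y i = x i)

open Classical in
/-- The configuration obtained from `x` by all replacements in `R`. (It is unique when the two
words of every pair have equal length; it exists if overlapping replacements are compatible.) -/
noncomputable def replaceAll {A : Type*} (R : Set (List A × List A)) (x : ℤ → A) : ℤ → A :=
  if h : ∃ y, IsReplacement R x y then h.choose else x

/-- The replacement rule that permutes the words of the list `L` cyclically: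
each word is replaced by the next one, and the last word by the first. -/
def cyclicRule {A : Type*} (L : List (List A)) : Set (List A × List A) :=
  {r | r ∈ L.zip (L.rotate 1)}

section Gliders

variable {A : Type*} (z o : List A)

/-- The leftbound glider `z^q o`, with `q = |o|`. -/
def gliderL : List A := wpow z o.length ++ o

/-- The rightbound glider `o^(p+1)`, with `p = |z|`. -/
def gliderR : List A := wpow o (z.length + 1)

/-- `p / K`, where `p = |z|`, `q = |o|` and `K = gcd(p, q)`. -/
def numClasses : ℕ := z.length / Nat.gcd z.length o.length

/-- The length of `o^(p + 1 + p/K)`. -/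
def paramBound : ℕ := (wpow o (z.length + 1 + numClasses z o)).length

/-- `P₁` exchanges `z (z^q o) z` and `z (o^(p+1)) z`. -/
noncomputable def mapP1 : (ℤ → A) → (ℤ → A) :=
  replaceAll (cyclicRule
    [z ++ (wpow z o.length ++ o) ++ z, z ++ wpow o (z.length + 1) ++ z])

/-- `P₂` exchanges `z (o^(p+1)) z` and `z (o z^q) z`. -/
noncomputable def mapP2 : (ℤ → A) → (ℤ → A) :=
  replaceAll (cyclicRule
    [z ++ wpow o (z.length + 1) ++ z, z ++ (o ++ wpow z o.length) ++ z])

/-- The word `u'_j = o z^q o^j`. -/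
def wordU (j : ℕ) : List A := o ++ wpow z o.length ++ wpow o j

/-- The set `U'_{j,n}`: nonempty words `w` of length at most `n - 1` without letters of `z`
such that `z w z ∈ L(X)` and `|w| ≡ (j+1)K (mod p)`; for `j = p/K` the words `o` and `o^(p+1)`
are left out. -/
def setU [TopologicalSpace A] (X : Subshift A) (n j : ℕ) : Set (List A) :=
  {w | w ≠ [] ∧ w.length < n ∧ (∀ a ∈ w, a ∉ z) ∧ z ++ w ++ z ∈ X.language ∧
    w.length ≡ (j + 1) * Nat.gcd z.length o.length [MOD z.length] ∧
    (j = numClasses z o → w ≠ o ∧ w ≠ wpow o (z.length + 1))}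

/-- The choices made in the construction of `P_{4,n}`: for `1 ≤ j ≤ p/K` an enumeration
`words j` (without repetitions) of the set `U'_{j,n}` that ends in `o^(p+1+j)`, and exponents
`c_j = padU j` and `c_{j,i} = pad j w` (where `w = u'_{j,i}`), all at least `q + 1`, such that
`u_j = z^{c_j} u'_j` and all `u_{j,i} = z^{c_{j,i}} u'_{j,i}` have the same length. -/
structure GliderChoice [TopologicalSpace A] (X : Subshift A) (n : ℕ) where
  words : ℕ → List (List A)
  padU : ℕ → ℕ
  pad : ℕ → List A → ℕ
  nodup : ∀ j, 1 ≤ j → j ≤ numClasses z o → (words j).Nodup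
  mem_iff : ∀ j, 1 ≤ j → j ≤ numClasses z o → ∀ w, w ∈ words j ↔ w ∈ setU z o X n j
  last : ∀ j, 1 ≤ j → j ≤ numClasses z o →
    (words j).getLast? = some (wpow o (z.length + 1 + j))
  le_padU : ∀ j, 1 ≤ j → j ≤ numClasses z o → o.length + 1 ≤ padU j
  le_pad : ∀ j, 1 ≤ j → j ≤ numClasses z o → ∀ w ∈ words j, o.length + 1 ≤ pad j w
  length_eq : ∀ j, 1 ≤ j → j ≤ numClasses z o → ∀ w ∈ words j,
    (wpow z (pad j w) ++ w).length = (wpow z (padU j) ++ wordU z o j).length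

variable {z o}

/-- The list `u_j z, u_{j,1} z, …, u_{j,n_j} z`. -/
def GliderChoice.cycle [TopologicalSpace A] {X : Subshift A} {n : ℕ}
    (c : GliderChoice z o X n) (j : ℕ) : List (List A) :=
  (wpow z (c.padU j) ++ wordU z o j ++ z) ::
    (c.words j).map (fun w => wpow z (c.pad j w) ++ w ++ z)

/-- `P_{4,n}` permutes, for each `1 ≤ j ≤ p/K`, the words of `U_{j,n} z` cyclically. -/
noncomputable def mapP4 [TopologicalSpace A] {X : Subshift A} {n : ℕ}
    (c : GliderChoice z o X n) : (ℤ → A) → (ℤ → A) :=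
  replaceAll (⋃ j ∈ Set.Icc 1 (numClasses z o), cyclicRule (c.cycle j))

/-- The glider map `G_{X,n} = P_{4,n} ∘ P₂ ∘ P₁`. -/
noncomputable def mapG [TopologicalSpace A] {X : Subshift A} {n : ℕ}
    (c : GliderChoice z o X n) : (ℤ → A) → (ℤ → A) :=
  mapP4 c ∘ mapP2 z o ∘ mapP1 z o

variable (z o)

/-- `F₁` exchanges `z gR z z z gL z` and `z gR z z gL z z`. -/
noncomputable def mapF1 : (ℤ → A) → (ℤ → A) :=
  replaceAll (cyclicRule
    [z ++ gliderR z o ++ z ++ z ++ z ++ gliderL z o ++ z,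
     z ++ gliderR z o ++ z ++ z ++ gliderL z o ++ z ++ z])

/-- `F₂` exchanges `z gR z z gL z` and `z z gR z gL z`. -/
noncomputable def mapF2 : (ℤ → A) → (ℤ → A) :=
  replaceAll (cyclicRule
    [z ++ gliderR z o ++ z ++ z ++ gliderL z o ++ z,
     z ++ z ++ gliderR z o ++ z ++ gliderL z o ++ z])

/-- The map `F = F₂ ∘ F₁`. -/
noncomputable def mapF : (ℤ → A) → (ℤ → A) :=
  mapF2 z o ∘ mapF1 z o

variable {z o}

/-- The set of automorphisms `{G_{X,n} | n > |o^(p+1+p/K)|} ∪ {F}`. -/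
def generators [TopologicalSpace A] (X : Subshift A)
    (c : ∀ n, paramBound z o < n → GliderChoice z o X n) : Set X.Aut :=
  {g | (∃ n, ∃ hn : paramBound z o < n, X.Restricts (mapG (c n hn)) g) ∨
    X.Restricts (mapF z o) g}

end Gliders

end SymbolicDynamics

/-! All maps involved replace words that begin and end with the marker `z`, permute finitely or
boundedly many such words, and have occurrences overlapping in at most one common marker
(`IsMarkerRule`). Such a replacement is well defined, local and shift-commuting, and the swapped
rule inverts it. It preserves `X` because `z` is synchronizing: whatever may stand between two
markers can be exchanged there, one occurrence at a time, and closedness handles infinitely many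
occurrences. For `P₁`, `P₂`, `P₄`, `F₁`, `F₂` the overlap condition is read off from the alternation
of runs of marker letters and runs free of them.

For the centralizers, let the move of `m` exchange `z o^a z m z z o^(a+1) z` and `z o^a z z m z
o^(a+1) z`, where `a` is large compared with `m` (`framedRule`). If `m = o^M` with `M` at least a
bound on the word lengths of a rule, then no word of that rule overlaps the framed words in more
than a marker: it would have to reach across a marker-free run that is too long
(`not_overlap_of_long_runs`). So the two replacements commute. The automorphisms commuting with all
moves of sufficiently long `o^M` form a subgroup, `eventualCentralizer`, which contains every
`G_{X,n}` and `F`. A finite subset of it has a common bound, hence is centralized by one move, which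
is not a power of `σ` (`zpowers_lt_centralizer`).

For the last claim `R` consists of the moves of all admissible words `m`. Each of them is bounded,
so `R` lies in `eventualCentralizer` and its finite subsets have too large a centralizer.
Conversely, an automorphism commuting with the move of `m` must send some occurrence of `m` to an
occurrence of `m` displaced by an amount bounded independently of `m` (`exists_occursAt_image`). If
it were no power of `σ`, each of the finitely many displacements would be refuted by some window,
and transitivity puts all these windows into one `m` (`centralizer_framedAuts`). -/

namespace SymbolicDynamics

/-! ### Occurrences of words in configurations -/

section Occurrences

variable {A : Type*} {x y : ℤ → A} {u v w : List A} {i k : ℤ}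

theorem occursAt_append :
    OccursAt x (u ++ v) i ↔ OccursAt x u i ∧ OccursAt x v (i + u.length) := by
  constructor
  · refine fun h => ⟨fun j hj => ?_, fun j hj => ?_⟩
    · rw [h j (by simp; omega), List.getElem_append_left hj]
    · have := h (u.length + j) (by simp; omega)
      rw [List.getElem_append_right (by omega)] at this
      simp only [Nat.add_sub_cancel_left] at this
      rw [← this]
      push_cast
      ring_nf
  · rintro ⟨h1, h2⟩ j hj
    by_cases hju : j < u.length
    · rw [List.getElem_append_left hju, h1 j hju]
    · rw [List.getElem_append_right (by omega)]
      rw [← h2 (j - u.length) (by simp at hj; omega)]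
      congr 1
      omega

theorem OccursAt.getElem_toNat (h : OccursAt x w k) (hi : k ≤ i) (hi' : i < k + w.length) :
    x i = w[(i - k).toNat]'(by omega) := by
  rw [← h (i - k).toNat (by omega)]
  congr 1
  omega

theorem OccursAt.congr (h : OccursAt x w k)
    (hxy : ∀ i, k ≤ i → i < k + w.length → y i = x i) : OccursAt y w k := fun j hj => by
  rw [hxy _ (by omega) (by omega), h j hj]

theorem OccursAt.apply_eq (h : OccursAt x w k) (h' : OccursAt y w k) (hi : k ≤ i)
    (hi' : i < k + w.length) : x i = y i := by
  rw [h.getElem_toNat hi hi', h'.getElem_toNat hi hi']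

theorem OccursAt.eq_of_length_eq (h : OccursAt x u k) (h' : OccursAt x v k)
    (huv : u.length = v.length) : u = v :=
  List.ext_getElem huv fun j h1 h2 => by rw [← h j h1, ← h' j h2]

theorem OccursAt.mem (h : OccursAt x w k) (hi : k ≤ i) (hi' : i < k + w.length) : x i ∈ w := by
  rw [h.getElem_toNat hi hi']
  exact List.getElem_mem _

theorem occursAt_comp_add (n : ℤ) :
    OccursAt (fun i => x (i + n)) w k ↔ OccursAt x w (k + n) :=
  forall₂_congr fun j hj => by
    show x (k + j + n) = _ ↔ _
    rw [show k + (j : ℤ) + n = k + n + j by ring]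

/-- Lets overlap conditions, which speak of occurrences in arbitrary configurations, be applied to
bare words; the configuration need not belong to `X`. -/
theorem exists_config_occursAt (hw : 0 < w.length) : ∃ x : ℤ → A, OccursAt x w 0 := by
  obtain ⟨a, -⟩ := List.exists_mem_of_length_pos hw
  exact ⟨fun i => w.getD i.toNat a, fun j hj => by simp [List.getD_eq_getElem?_getD, hj]⟩

/-- The word that occurs in `x` at position `k` and has length `n`. -/
def window (x : ℤ → A) (k : ℤ) (n : ℕ) : List A := List.ofFn fun j : Fin n => x (k + j)

@[simp] theorem length_window (n : ℕ) : (window x k n).length = n := by simp [window]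

theorem occursAt_window (n : ℕ) : OccursAt x (window x k n) k := fun j hj => by simp [window]

end Occurrences

/-! ### Marker rules -/

/-- A replacement rule whose words all begin and end with the marker `z`, which permutes its
words and for which two occurrences of words overlap at most in a common marker. -/
structure IsMarkerRule {A : Type*} (z : List A) (R : Set (List A × List A)) : Prop where
  marker_pos : 0 < z.length
  length_eq : ∀ r ∈ R, r.1.length = r.2.length
  bordered : ∀ r ∈ R, ∃ m, r.1 = z ++ m ++ z
  overlap : ∀ (x : ℤ → A) (k l : ℤ), ∀ r ∈ R, ∀ s ∈ R, OccursAt x r.1 k → OccursAt x s.1 l →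
    k ≤ l → l + z.length < k + r.1.length → k = l ∧ r = s
  injective : ∀ r ∈ R, ∀ s ∈ R, r.2 = s.2 → r = s
  succ : ∀ r ∈ R, ∃ s ∈ R, s.1 = r.2
  pred : ∀ r ∈ R, ∃ s ∈ R, s.2 = r.1

namespace IsMarkerRule

variable {A : Type*} {z : List A} {R S : Set (List A × List A)} {x y : ℤ → A} {k l i : ℤ}
  {r s : List A × List A}

theorem bordered_snd (hR : IsMarkerRule z R) (hr : r ∈ R) : ∃ m, r.2 = z ++ m ++ z := by
  obtain ⟨s, hs, h⟩ := hR.succ r hr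
  rw [← h]
  exact hR.bordered s hs

theorem two_mul_le (hR : IsMarkerRule z R) (hr : r ∈ R) : 2 * z.length ≤ r.1.length := by
  obtain ⟨m, hm⟩ := hR.bordered r hr
  rw [hm]
  simp
  omega

theorem overlap_snd (hR : IsMarkerRule z R) (hr : r ∈ R) (hs : s ∈ R)
    (h : OccursAt x r.2 k) (h' : OccursAt x s.2 l) (hkl : k ≤ l)
    (hlk : l + z.length < k + r.1.length) : k = l ∧ r = s := by
  obtain ⟨r', hr', h1⟩ := hR.succ r hr
  obtain ⟨s', hs', h2⟩ := hR.succ s hs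
  obtain ⟨h3, h4⟩ := hR.overlap x k l r' hr' s' hs' (h1 ▸ h) (h2 ▸ h') hkl
    (by rw [h1, ← hR.length_eq r hr]; exact hlk)
  exact ⟨h3, hR.injective r hr s hs (by rw [← h1, ← h2, h4])⟩

/-- This is the rule of the inverse map. Its injectivity is `overlap` applied to a word placed at 0
twice. -/
theorem swap (hR : IsMarkerRule z R) : IsMarkerRule z (Prod.swap '' R) where
  marker_pos := hR.marker_pos
  length_eq := by
    rintro _ ⟨r, hr, rfl⟩
    exact (hR.length_eq r hr).symm
  bordered := by
    rintro _ ⟨r, hr, rfl⟩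
    exact hR.bordered_snd hr
  overlap := by
    rintro x k l _ ⟨r, hr, rfl⟩ _ ⟨s, hs, rfl⟩ h h' hkl hlk
    obtain ⟨h1, h2⟩ := hR.overlap_snd hr hs h h' hkl
      (by rw [hR.length_eq r hr]; exact hlk)
    exact ⟨h1, by rw [h2]⟩
  injective := by
    rintro _ ⟨r, hr, rfl⟩ _ ⟨s, hs, rfl⟩ h
    have h : r.1 = s.1 := h
    have h0 := hR.two_mul_le hr
    have h1 := hR.marker_pos
    obtain ⟨x, hocc⟩ := exists_config_occursAt (w := r.1) (by omega)
    rw [(hR.overlap _ 0 0 r hr s hs hocc (h ▸ hocc) le_rfl (by omega)).2]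
  succ := by
    rintro _ ⟨r, hr, rfl⟩
    obtain ⟨s, hs, h⟩ := hR.pred r hr
    exact ⟨s.swap, ⟨s, hs, rfl⟩, h⟩
  pred := by
    rintro _ ⟨r, hr, rfl⟩
    obtain ⟨s, hs, h⟩ := hR.succ r hr
    exact ⟨s.swap, ⟨s, hs, rfl⟩, h⟩

theorem marker_left (hR : IsMarkerRule z R) (hr : r ∈ R) (h : OccursAt x r.1 k) :
    OccursAt x z k := by
  obtain ⟨m, hm⟩ := hR.bordered r hr
  rw [hm, occursAt_append, occursAt_append] at h
  exact h.1.1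

theorem marker_right (hR : IsMarkerRule z R) (hr : r ∈ R) (h : OccursAt x r.1 k) :
    OccursAt x z (k + r.1.length - z.length) := by
  obtain ⟨m, hm⟩ := hR.bordered r hr
  rw [hm, occursAt_append] at h
  have := h.2
  rw [hm]
  convert this using 1
  simp
  ring

end IsMarkerRule

/-! ### Existence, uniqueness and invertibility of replacements -/

open Classical in
/-- The replacement of those occurrences of first words of pairs in `R` that start in `F`;
only the letters between the two markers of length `p` are touched. -/
noncomputable def replaceOn {A : Type*} (p : ℕ) (R : Set (List A × List A)) (F : Set ℤ)
    (x : ℤ → A) : ℤ → A := fun i =>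
  if h : ∃ a, ∃ r ∈ R, ∃ k ∈ F, OccursAt x r.1 k ∧ k + p ≤ i ∧ i + p < k + r.1.length ∧
    r.2[(i - k).toNat]? = some a then h.choose else x i

namespace IsMarkerRule

variable {A : Type*} {z : List A} {R S : Set (List A × List A)} {x y : ℤ → A} {k l i : ℤ}
  {r s : List A × List A} {F : Set ℤ}

/-- The choice in `replaceOn` is harmless: two occurrences with `i` in both interiors share more
than a marker, so they coincide. -/
theorem replaceOn_eq_getElem (hR : IsMarkerRule z R) (hr : r ∈ R) (hk : k ∈ F)
    (h : OccursAt x r.1 k) (hi : k + z.length ≤ i) (hi' : i + z.length < k + r.1.length) :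
    r.2[(i - k).toNat]? = some (replaceOn z.length R F x i) := by
  have hlen := hR.length_eq r hr
  have hex : ∃ a, ∃ r ∈ R, ∃ k ∈ F, OccursAt x r.1 k ∧ k + z.length ≤ i ∧
      i + z.length < k + r.1.length ∧ r.2[(i - k).toNat]? = some a :=
    ⟨_, r, hr, k, hk, h, hi, hi', List.getElem?_eq_getElem (by omega)⟩
  rw [replaceOn, dif_pos hex]
  obtain ⟨s, hs, l, hl, h2, hi2, hi2', he⟩ := hex.choose_spec
  rw [← he]
  rcases le_total k l with hkl | hkl
  · obtain ⟨rfl, rfl⟩ := hR.overlap x k l r hr s hs h h2 hkl (by omega)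
    rfl
  · obtain ⟨rfl, rfl⟩ := hR.overlap x l k s hs r hr h2 h hkl (by omega)
    rfl

theorem replaceOn_eq_self
    (h : ∀ r ∈ R, ∀ k ∈ F, OccursAt x r.1 k → k + z.length ≤ i → k + r.1.length ≤ i + z.length) :
    replaceOn z.length R F x i = x i := by
  rw [replaceOn, dif_neg]
  rintro ⟨a, r, hr, k, hk, hx, h1, h2, -⟩
  have := h r hr k hk hx h1
  omega

theorem replaceOn_border (hR : IsMarkerRule z R) (hr : r ∈ R) (h : OccursAt x r.1 k)
    (hi : k ≤ i) (hi' : i < k + r.1.length)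
    (hn : ¬ (k + z.length ≤ i ∧ i + z.length < k + r.1.length)) :
    replaceOn z.length R F x i = x i :=
  replaceOn_eq_self fun s hs l hl hsl h1 => by
    by_contra h2
    rcases le_total k l with hkl | hkl
    · obtain ⟨rfl, rfl⟩ := hR.overlap x k l r hr s hs h hsl hkl (by omega)
      omega
    · obtain ⟨rfl, rfl⟩ := hR.overlap x l k s hs r hr hsl h hkl (by omega)
      omega

theorem replaceOn_congr (hR : IsMarkerRule z R) {F' : Set ℤ}
    (h : ∀ r ∈ R, ∀ k, OccursAt x r.1 k → k + z.length ≤ i → i + z.length < k + r.1.length →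
      (k ∈ F ↔ k ∈ F')) : replaceOn z.length R F x i = replaceOn z.length R F' x i := by
  by_cases hc : ∃ r ∈ R, ∃ k ∈ F, OccursAt x r.1 k ∧ k + z.length ≤ i ∧
      i + z.length < k + r.1.length
  · obtain ⟨r, hr, k, hk, h1, h2, h3⟩ := hc
    exact Option.some.inj ((hR.replaceOn_eq_getElem hr hk h1 h2 h3).symm.trans
      (hR.replaceOn_eq_getElem hr ((h r hr k h1 h2 h3).1 hk) h1 h2 h3))
  · push Not at hc
    rw [replaceOn_eq_self fun r hr k hk h1 h2 => hc r hr k hk h1 h2,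
      replaceOn_eq_self fun r hr k hk h1 h2 => ?_]
    by_contra h3
    exact h3 (hc r hr k ((h r hr k h1 h2 (by omega)).2 hk) h1 h2)

theorem occursAt_replaceOn (hR : IsMarkerRule z R) (hr : r ∈ R) (hk : k ∈ F)
    (h : OccursAt x r.1 k) : OccursAt (replaceOn z.length R F x) r.2 k := by
  obtain ⟨m, hm⟩ := hR.bordered_snd hr
  have hlen := hR.length_eq r hr
  have h0 := hR.marker_pos
  have hborder : ∀ i, k ≤ i → i < k + r.1.length →
      ¬ (k + z.length ≤ i ∧ i + z.length < k + r.1.length) →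
      replaceOn z.length R F x i = x i := fun i => hR.replaceOn_border hr h
  have hl := hR.marker_left hr h
  have hr' := hR.marker_right hr h
  have hml : r.2.length = z.length + (m.length + z.length) := by rw [hm]; simp
  have h1 : OccursAt (replaceOn z.length R F x) z k :=
    hl.congr fun i hi hi' => hborder i hi (by omega) (by omega)
  have h2 : OccursAt (replaceOn z.length R F x) z (k + r.1.length - z.length) :=
    hr'.congr fun i hi hi' => hborder i (by omega) (by omega) (by omega)
  rw [hm, occursAt_append, occursAt_append]
  refine ⟨⟨h1, fun j hj => ?_⟩, ?_⟩
  · have := hR.replaceOn_eq_getElem (i := k + z.length + j) hr hk h (by omega) (by omega)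
    have hj' : (k + z.length + j - k).toNat = z.length + j := by omega
    rw [hj', hm, List.append_assoc, List.getElem?_append_right (by omega),
      List.getElem?_append_left (by omega), Nat.add_sub_cancel_left,
      List.getElem?_eq_getElem hj] at this
    exact (Option.some.inj this).symm
  · convert h2 using 1
    simp
    omega

theorem isReplacement_replaceOn (hR : IsMarkerRule z R) :
    IsReplacement R x (replaceOn z.length R Set.univ x) :=
  ⟨fun _ hr _ h => hR.occursAt_replaceOn hr (Set.mem_univ _) h, fun i h =>
    replaceOn_eq_self fun r hr k _ hx h1 => by
      by_contra h2
      exact h r hr k hx ⟨by omega, by omega⟩⟩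

theorem isReplacement_unique (hR : IsMarkerRule z R) {y' : ℤ → A} (h : IsReplacement R x y)
    (h' : IsReplacement R x y') : y = y' := by
  funext i
  by_cases hc : ∃ r ∈ R, ∃ k, OccursAt x r.1 k ∧ k ≤ i ∧ i < k + r.1.length
  · obtain ⟨r, hr, k, hk, h1, h2⟩ := hc
    exact (h.1 r hr k hk).apply_eq (h'.1 r hr k hk) h1 (by rw [← hR.length_eq r hr]; exact h2)
  · push Not at hc
    rw [h.2 i fun r hr k hk h1 => (hc r hr k hk h1.1).not_gt h1.2,
      h'.2 i fun r hr k hk h1 => (hc r hr k hk h1.1).not_gt h1.2]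

theorem isReplacement_replaceAll (hR : IsMarkerRule z R) (x : ℤ → A) :
    IsReplacement R x (replaceAll R x) := by
  have hex : ∃ y, IsReplacement R x y := ⟨_, hR.isReplacement_replaceOn⟩
  rw [replaceAll, dif_pos hex]
  exact hex.choose_spec

theorem replaceAll_eq (hR : IsMarkerRule z R) (h : IsReplacement R x y) : replaceAll R x = y :=
  hR.isReplacement_unique (hR.isReplacement_replaceAll x) h

theorem replaceAll_eq_self (hR : IsMarkerRule z R)
    (h : ∀ r ∈ R, ∀ k, ¬ OccursAt x r.1 k) : replaceAll R x = x :=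
  hR.replaceAll_eq ⟨fun r hr k hk => absurd hk (h r hr k), fun _ _ => rfl⟩

theorem occursAt_replaceAll (hR : IsMarkerRule z R) (hr : r ∈ R) (h : OccursAt x r.1 k) :
    OccursAt (replaceAll R x) r.2 k := (hR.isReplacement_replaceAll x).1 r hr k h

/-- Away from the interior of the occurrences nothing changes. -/
theorem replaceAll_apply_eq_self (hR : IsMarkerRule z R)
    (h : ∀ r ∈ R, ∀ k, OccursAt x r.1 k → k + z.length ≤ i → k + r.1.length ≤ i + z.length) :
    replaceAll R x i = x i := by
  rw [hR.replaceAll_eq hR.isReplacement_replaceOn]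
  exact replaceOn_eq_self fun r hr k _ => h r hr k

/-- No word arises by accident, which is what makes the map invertible. If an old occurrence shares
more than a marker with the new word, its image does too, and the overlap condition identifies the
two. Otherwise nothing changed there, so the word was already present in `x` and was itself replaced
by a word equal to it; injectivity of the rule concludes. -/
theorem occursAt_of_replaceAll (hR : IsMarkerRule z R) (hr : r ∈ R)
    (h : OccursAt (replaceAll R x) r.2 k) : OccursAt x r.1 k := by
  have hlen := hR.length_eq r hr
  have h2 := hR.two_mul_le hr
  have h0 := hR.marker_pos
  by_cases hex : ∃ t ∈ R, ∃ l, OccursAt x t.1 l ∧ k + z.length < l + t.1.length ∧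
      l + z.length < k + r.1.length
  · obtain ⟨t, ht, l, hl, h3, h4⟩ := hex
    have hl' := hR.occursAt_replaceAll ht hl
    rcases le_total k l with hkl | hkl
    · obtain ⟨rfl, rfl⟩ := hR.overlap_snd hr ht h hl' hkl h4
      exact hl
    · obtain ⟨rfl, rfl⟩ := hR.overlap_snd ht hr hl' h hkl h3
      exact hl
  · obtain ⟨s, hs, hsr⟩ := hR.succ r hr
    have hx : OccursAt x s.1 k := by
      rw [hsr]
      refine h.congr fun i hi hi' => (hR.replaceAll_apply_eq_self fun t ht l hl h3 => ?_).symm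
      by_contra h4
      exact hex ⟨t, ht, l, hl, by omega, by omega⟩
    have h5 : s.2 = r.2 := (hR.occursAt_replaceAll hs hx).eq_of_length_eq h
      (by rw [← hR.length_eq s hs, hsr])
    rwa [hR.injective s hs r hr h5] at hx

theorem replaceAll_swap_replaceAll (hR : IsMarkerRule z R) (x : ℤ → A) :
    replaceAll (Prod.swap '' R) (replaceAll R x) = x := by
  refine hR.swap.replaceAll_eq ⟨?_, fun i h => ?_⟩
  · rintro _ ⟨r, hr, rfl⟩ k hk
    exact hR.occursAt_of_replaceAll hr hk
  · refine ((hR.isReplacement_replaceAll x).2 i fun r hr k hk hki => ?_).symm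
    refine h r.swap ⟨r, hr, rfl⟩ k (hR.occursAt_replaceAll hr hk) ⟨hki.1, ?_⟩
    have := hR.length_eq r hr
    have : r.swap.1 = r.2 := rfl
    rw [this]
    omega

theorem replaceAll_replaceAll_swap (hR : IsMarkerRule z R) (x : ℤ → A) :
    replaceAll R (replaceAll (Prod.swap '' R) x) = x := by
  have := hR.swap.replaceAll_swap_replaceAll x
  rwa [← Set.image_comp, Prod.swap_swap_eq, Set.image_id] at this

theorem replaceAll_shiftMap (hR : IsMarkerRule z R) (x : ℤ → A) :
    replaceAll R (shiftMap x) = shiftMap (replaceAll R x) := by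
  refine hR.replaceAll_eq ⟨fun r hr k hk => ?_, fun i h => ?_⟩
  · exact (occursAt_comp_add 1).2 (hR.occursAt_replaceAll hr ((occursAt_comp_add 1).1 hk))
  · refine (hR.isReplacement_replaceAll x).2 (i + 1) fun r hr k hk hki => ?_
    refine h r hr (k - 1) ((occursAt_comp_add 1).2 ?_) (by omega)
    rwa [sub_add_cancel]

theorem replaceAll_congr (hR : IsMarkerRule z R) {N : ℕ} (hN : ∀ r ∈ R, r.1.length ≤ N)
    (h : ∀ j, i - N ≤ j → j ≤ i + N → x j = y j) : replaceAll R x i = replaceAll R y i := by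
  have hx := hR.isReplacement_replaceAll x
  have hy := hR.isReplacement_replaceAll y
  by_cases hc : ∃ r ∈ R, ∃ k, OccursAt x r.1 k ∧ k ≤ i ∧ i < k + r.1.length
  · obtain ⟨r, hr, k, hk, h1, h2⟩ := hc
    have := hN r hr
    refine (hx.1 r hr k hk).apply_eq (hy.1 r hr k ?_) h1 (by rw [← hR.length_eq r hr]; exact h2)
    exact hk.congr fun j hj hj' => (h j (by omega) (by omega)).symm
  · push Not at hc
    rw [hx.2 i fun r hr k hk h1 => (hc r hr k hk h1.1).not_gt h1.2,
      hy.2 i fun r hr k hk h1 => ?_, h i (by omega) (by omega)]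
    have := hN r hr
    exact (hc r hr k (hk.congr fun j hj hj' => h j (by omega) (by omega)) h1.1).not_gt h1.2

end IsMarkerRule

/-! ### Commuting replacements -/

/-- Occurrences of words of `R` and of words of `S` overlap at most in a marker. -/
def NonInteracting {A : Type*} (z : List A) (R S : Set (List A × List A)) : Prop :=
  ∀ (x : ℤ → A) (k l : ℤ), ∀ r ∈ R, ∀ s ∈ S, OccursAt x r.1 k → OccursAt x s.1 l →
    k + r.1.length ≤ l + z.length ∨ l + s.1.length ≤ k + z.length

theorem NonInteracting.symm {A : Type*} {z : List A} {R S : Set (List A × List A)}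
    (h : NonInteracting z R S) : NonInteracting z S R :=
  fun x k l r hr s hs h1 h2 => (h x l k s hs r hr h2 h1).symm

namespace IsMarkerRule

variable {A : Type*} {z : List A} {R S : Set (List A × List A)} {x y : ℤ → A} {k l i : ℤ}
  {r s : List A × List A}

theorem union (hR : IsMarkerRule z R) (hS : IsMarkerRule z S) (hRS : NonInteracting z R S) :
    IsMarkerRule z (R ∪ S) where
  marker_pos := hR.marker_pos
  length_eq r hr := hr.elim (hR.length_eq r) (hS.length_eq r)
  bordered r hr := hr.elim (hR.bordered r) (hS.bordered r)
  overlap := by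
    have h0 := hR.marker_pos
    rintro x k l r (hr | hr) s (hs | hs) h h' hkl hlk
    · exact hR.overlap x k l r hr s hs h h' hkl hlk
    · have := hRS x k l r hr s hs h h'
      have := hS.two_mul_le hs
      omega
    · have := hRS x l k s hs r hr h' h
      have := hR.two_mul_le hs
      omega
    · exact hS.overlap x k l r hr s hs h h' hkl hlk
  injective := by
    have key : ∀ r ∈ R, ∀ s ∈ S, r.2 ≠ s.2 := by
      intro r hr s hs h
      obtain ⟨r', hr', h1⟩ := hR.succ r hr
      obtain ⟨s', hs', h2⟩ := hS.succ s hs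
      have h3 := hR.two_mul_le hr'
      have h4 := hR.marker_pos
      have h5 : s'.1 = r'.1 := by rw [h1, h2, h]
      obtain ⟨x, hocc⟩ := exists_config_occursAt (w := r'.1) (by omega)
      have := hRS _ 0 0 r' hr' s' hs' hocc (h5 ▸ hocc)
      rw [h5] at this
      omega
    rintro r (hr | hr) s (hs | hs) h
    · exact hR.injective r hr s hs h
    · exact absurd h (key r hr s hs)
    · exact absurd h.symm (key s hs r hr)
    · exact hS.injective r hr s hs h
  succ := by
    rintro r (hr | hr)
    · exact (hR.succ r hr).imp fun s hs => ⟨Or.inl hs.1, hs.2⟩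
    · exact (hS.succ r hr).imp fun s hs => ⟨Or.inr hs.1, hs.2⟩
  pred := by
    rintro r (hr | hr)
    · exact (hR.pred r hr).imp fun s hs => ⟨Or.inl hs.1, hs.2⟩
    · exact (hS.pred r hr).imp fun s hs => ⟨Or.inr hs.1, hs.2⟩

/-- The converse direction also needs that the new words of `R` keep away from `S`; they do, being
first words of `R` as well. -/
theorem occursAt_replaceAll_iff (hR : IsMarkerRule z R) (hRS : NonInteracting z R S)
    (hs : s ∈ S) : OccursAt (replaceAll R x) s.1 k ↔ OccursAt x s.1 k := by
  constructor
  · refine fun h => h.congr fun i hi hi' =>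
      (hR.replaceAll_apply_eq_self fun r hr l hl h1 => ?_).symm
    obtain ⟨r', hr', h2⟩ := hR.succ r hr
    have h3 := hRS _ l k r' hr' s hs (h2 ▸ hR.occursAt_replaceAll hr hl) h
    rw [h2, ← hR.length_eq r hr] at h3
    omega
  · refine fun h => h.congr fun i hi hi' => hR.replaceAll_apply_eq_self fun r hr l hl h1 => ?_
    have h3 := hRS _ l k r hr s hs hl h
    omega

/-- The right-hand side is symmetric in the two rules, whence commutation. -/
theorem replaceAll_replaceAll (hR : IsMarkerRule z R) (hS : IsMarkerRule z S)
    (hRS : NonInteracting z R S) (x : ℤ → A) :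
    replaceAll S (replaceAll R x) = replaceAll (R ∪ S) x := by
  have hU := hR.union hS hRS
  refine hS.replaceAll_eq ⟨fun s hs k hk => ?_, fun i h => ?_⟩
  · exact hU.occursAt_replaceAll (Or.inr hs) ((hR.occursAt_replaceAll_iff hRS hs).1 hk)
  · by_cases hc : ∃ r ∈ R, ∃ k, OccursAt x r.1 k ∧ k ≤ i ∧ i < k + r.1.length
    · obtain ⟨r, hr, k, hk, h1, h2⟩ := hc
      exact (hU.occursAt_replaceAll (Or.inl hr) hk).apply_eq (hR.occursAt_replaceAll hr hk) h1
        (by rw [← hR.length_eq r hr]; exact h2)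
    · push Not at hc
      rw [(hR.isReplacement_replaceAll x).2 i
        fun r hr k hk h1 => (hc r hr k hk h1.1).not_gt h1.2]
      refine (hU.isReplacement_replaceAll x).2 i ?_
      rintro r (hr | hr) k hk h1
      · exact (hc r hr k hk h1.1).not_gt h1.2
      · exact h r hr k ((hR.occursAt_replaceAll_iff hRS hr).2 hk) h1

theorem replaceAll_comm (hR : IsMarkerRule z R) (hS : IsMarkerRule z S)
    (hRS : NonInteracting z R S) (x : ℤ → A) :
    replaceAll S (replaceAll R x) = replaceAll R (replaceAll S x) := by
  rw [hR.replaceAll_replaceAll hS hRS, hS.replaceAll_replaceAll hR hRS.symm, Set.union_comm]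

end IsMarkerRule

/-! ### Gluing at the synchronizing marker -/

namespace Subshift

variable {A : Type*} [TopologicalSpace A] {X : Subshift A} {z : List A} {x y : ℤ → A}

theorem comp_add_mem (hx : x ∈ X.carrier) (n : ℤ) : (fun i => x (i + n)) ∈ X.carrier := by
  induction n with
  | zero => simpa using hx
  | succ n ih =>
    convert X.shift_mem ih using 1
    funext i
    show _ = x (i + 1 + n)
    ring_nf
  | pred n ih =>
    convert X.unshift_mem ih using 1
    funext i
    show _ = x (i - 1 + -n)
    ring_nf

theorem mem_language (hx : x ∈ X.carrier) {w : List A} {k : ℤ} (h : OccursAt x w k) :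
    w ∈ X.language := ⟨x, hx, k, h⟩

theorem exists_occursAt {w : List A} (hw : w ∈ X.language) (k : ℤ) :
    ∃ x ∈ X.carrier, OccursAt x w k := by
  obtain ⟨x, hx, i, h⟩ := hw
  refine ⟨_, X.comp_add_mem hx (i - k), (occursAt_comp_add _).2 ?_⟩
  simpa using h

theorem left_mem_language {u v : List A} (h : u ++ v ∈ X.language) : u ∈ X.language := by
  obtain ⟨x, hx, i, h⟩ := h
  exact ⟨x, hx, i, (occursAt_append.1 h).1⟩

theorem right_mem_language {u v : List A} (h : u ++ v ∈ X.language) : v ∈ X.language := by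
  obtain ⟨x, hx, i, h⟩ := h
  exact ⟨x, hx, _, (occursAt_append.1 h).2⟩

theorem mem_of_forall_approx (h : ∀ n : ℕ, ∃ y ∈ X.carrier, ∀ i : ℤ, -n ≤ i → i ≤ n → y i = x i) :
    x ∈ X.carrier := by
  choose y hy hyx using h
  refine X.isClosed.mem_of_tendsto (f := y) (b := Filter.atTop) ?_ (Filter.Eventually.of_forall hy)
  refine tendsto_pi_nhds.2 fun i => tendsto_const_nhds.congr' ?_
  filter_upwards [Filter.eventually_ge_atTop i.natAbs] with n hn
  exact (hyx n i (by omega) (by omega)).symm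

/-- Synchronization gives this for finite windows on both sides of the marker; closedness of `X`
passes to the limit. -/
theorem glue_mem (hz : X.IsSynchronizingWord z) (hx : x ∈ X.carrier) (hy : y ∈ X.carrier) {k : ℤ}
    (hxz : OccursAt x z k) (hyz : OccursAt y z k) :
    (fun i => if i < k then x i else y i) ∈ X.carrier := by
  refine mem_of_forall_approx fun n => ?_
  -- Large enough for the word `u ++ z ++ v`, placed at `k - N`, to cover `[-n, n]`.
  set N := n + k.natAbs + 1
  have hu := occursAt_window (x := x) (k := k - N) N
  have hv := occursAt_window (x := y) (k := k + z.length) N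
  set u := window x (k - N) N
  set v := window y (k + z.length) N
  have hul : u.length = N := length_window N
  have hvl : v.length = N := length_window N
  have hw : u ++ z ++ v ∈ X.language := by
    refine hz.2 u (mem_language hx hu) v (mem_language hy hv) (mem_language hx (k := k - N) ?_)
      (mem_language hy (k := k) ?_)
    · refine occursAt_append.2 ⟨hu, ?_⟩
      rwa [hul, sub_add_cancel]
    · exact occursAt_append.2 ⟨hyz, hv⟩
  obtain ⟨t, ht, hto⟩ := exists_occursAt hw (k - N)
  rw [occursAt_append, occursAt_append, List.length_append] at hto
  obtain ⟨⟨h1, h2⟩, h3⟩ := hto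
  refine ⟨t, ht, fun i hi hi' => ?_⟩
  split_ifs with hik
  · exact h1.apply_eq hu (by omega) (by omega)
  · rw [hul, sub_add_cancel] at h2
    by_cases hik' : i < k + z.length
    · exact h2.apply_eq hyz (by omega) hik'
    · rw [show k - N + ((u.length + z.length : ℕ) : ℤ) = k + z.length by rw [hul]; push_cast; ring]
        at h3
      exact h3.apply_eq hv (by omega) (by omega)

/-- Between two markers a word of the language may be put in. -/
theorem exists_splice (hz : X.IsSynchronizingWord z) (hx : x ∈ X.carrier) {k : ℤ} {m : List A}
    (hm : z ++ m ++ z ∈ X.language) (h1 : OccursAt x z k)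
    (h2 : OccursAt x z (k + (z ++ m).length)) :
    ∃ y ∈ X.carrier, OccursAt y (z ++ m ++ z) k ∧
      ∀ i, (i < k ∨ k + (z ++ m ++ z).length ≤ i) → y i = x i := by
  obtain ⟨t, ht, hto⟩ := exists_occursAt hm k
  have ht1 : OccursAt t z k := (occursAt_append.1 (occursAt_append.1 hto).1).1
  have ht2 : OccursAt t z (k + (z ++ m).length) := (occursAt_append.1 hto).2
  have hl := List.length_append (as := z) (bs := m)
  have hl' := List.length_append (as := z ++ m) (bs := z)
  have hs := glue_mem hz hx ht h1 ht1
  have hs2 := glue_mem hz hs hx (k := k + (z ++ m).length) (ht2.congr fun i hi _ => by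
    rw [if_neg (by omega)]) h2
  refine ⟨_, hs2, ?_, fun i hi => ?_⟩
  · refine occursAt_append.2 ⟨(occursAt_append.1 hto).1.congr fun i hi hi' => ?_,
      h2.congr fun i hi hi' => ?_⟩
    · rw [if_pos hi', if_neg (by omega)]
    · rw [if_neg (by omega)]
  · rcases hi with hi | hi
    · rw [if_pos (by omega), if_pos hi]
    · rw [if_neg (by omega)]

end Subshift

/-! ### Bounded marker rules define automorphisms -/

/-- One occurrence at a time: its bordering markers survive the earlier replacements, so the new
word can be spliced in between them. -/
theorem IsMarkerRule.replaceOn_mem {A : Type*} [TopologicalSpace A] {X : Subshift A} {z : List A}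
    {R : Set (List A × List A)} (hR : IsMarkerRule z R) (hz : X.IsSynchronizingWord z)
    (hL : ∀ r ∈ R, r.1 ∈ X.language) {x : ℤ → A} (hx : x ∈ X.carrier) (F : Finset ℤ) :
    replaceOn z.length R F x ∈ X.carrier := by
  induction F using Finset.induction_on with
  | empty =>
    convert hx using 1
    funext i
    exact replaceOn_eq_self fun r hr k hk => absurd hk (by simp)
  | insert k F hk ih =>
    by_cases hc : ∃ r ∈ R, OccursAt x r.1 k
    · obtain ⟨r, hr, hrk⟩ := hc
      obtain ⟨m, hm⟩ := hR.bordered_snd hr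
      obtain ⟨s, hs, hsr⟩ := hR.succ r hr
      have hlen := hR.length_eq r hr
      have h2p := hR.two_mul_le hr
      have h0 := hR.marker_pos
      have hl : (z ++ m).length + z.length = r.1.length := by rw [hlen, hm]; simp; omega
      have h1 := hR.marker_left hr hrk
      have h2 := hR.marker_right hr hrk
      obtain ⟨y, hy, hyr, hyx⟩ := Subshift.exists_splice hz ih (k := k) (m := m)
        (by rw [← hm, ← hsr]; exact hL s hs)
        (h1.congr fun i hi hi' => hR.replaceOn_border hr hrk hi (by omega) (by omega))
        (by
          rw [show k + ((z ++ m).length : ℤ) = k + r.1.length - z.length by omega]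
          exact h2.congr fun i hi hi' =>
            hR.replaceOn_border hr hrk (by omega) (by omega) (by omega))
      rw [← hm] at hyr hyx
      convert hy using 1
      funext i
      by_cases hi : k ≤ i ∧ i < k + r.1.length
      · exact (hR.occursAt_replaceOn hr (by simp) hrk).apply_eq hyr hi.1 (by omega)
      · rw [hyx i (by omega)]
        refine hR.replaceOn_congr fun s hs l hl h3 h4 => ?_
        have : l ≠ k := by
          rintro rfl
          have := (hR.overlap x l l r hr s hs hrk hl le_rfl (by omega)).2
          subst this
          omega
        simp [this]
    · convert ih using 1
      funext i
      refine hR.replaceOn_congr fun s hs l hl h3 h4 => ?_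
      have : l ≠ k := by
        rintro rfl
        exact hc ⟨s, hs, hl⟩
      simp [this]

theorem IsMarkerRule.replaceAll_mem {A : Type*} [TopologicalSpace A] {X : Subshift A} {z : List A}
    {R : Set (List A × List A)} (hR : IsMarkerRule z R) (hz : X.IsSynchronizingWord z)
    (hL : ∀ r ∈ R, r.1 ∈ X.language) {N : ℕ} (hN : ∀ r ∈ R, r.1.length ≤ N) {x : ℤ → A}
    (hx : x ∈ X.carrier) : replaceAll R x ∈ X.carrier := by
  rw [hR.replaceAll_eq hR.isReplacement_replaceOn]
  refine Subshift.mem_of_forall_approx fun n =>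
    -- Every occurrence whose interior meets `[-n, n]` starts in this interval.
    ⟨_, hR.replaceOn_mem hz hL hx (Finset.Icc (-n - N) n), fun i hi hi' => ?_⟩
  refine hR.replaceOn_congr fun r hr k _ h1 h2 => ?_
  have := hN r hr
  simp
  omega

theorem continuous_of_local {A : Type*} [TopologicalSpace A] [DiscreteTopology A]
    {X : Subshift A} {f : (ℤ → A) → (ℤ → A)} (hf : ∀ x ∈ X.carrier, f x ∈ X.carrier)
    (N : ℕ) (h : ∀ (x y : ℤ → A) (i : ℤ), (∀ j, i - N ≤ j → j ≤ i + N → x j = y j) →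
      f x i = f y i) :
    Continuous fun x : X.carrier => (⟨f x.1, hf x.1 x.2⟩ : X.carrier) := by
  refine Continuous.subtype_mk (continuous_pi fun i => ?_) _
  refine IsLocallyConstant.continuous ((IsLocallyConstant.iff_eventually_eq _).2 fun x => ?_)
  have hev : ∀ᶠ y : X.carrier in nhds x, ∀ j ∈ Finset.Icc (i - N) (i + N), y.1 j = x.1 j :=
    (Filter.eventually_all_finset _).2 fun j _ =>
      (((continuous_apply j).comp continuous_subtype_val).tendsto x).eventually
        (mem_nhds_discrete.2 rfl : {x.1 j} ∈ nhds (x.1 j))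
  filter_upwards [hev] with y hy
  exact h _ _ i fun j hj hj' => hy j (Finset.mem_Icc.2 ⟨hj, hj'⟩)

theorem Subshift.mem_aut_iff {A : Type*} [TopologicalSpace A] {X : Subshift A}
    {g : X.carrier ≃ₜ X.carrier} :
    g ∈ X.Aut ↔ ∀ x : X.carrier, g (X.shiftHomeo x) = X.shiftHomeo (g x) := by
  rw [Subshift.Aut, Subgroup.mem_centralizer_singleton_iff]
  constructor
  · exact fun h x => DFunLike.congr_fun h x
  · exact fun h => Homeomorph.ext h

theorem IsMarkerRule.exists_aut {A : Type*} [TopologicalSpace A] [DiscreteTopology A]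
    {X : Subshift A} {z : List A} {R : Set (List A × List A)} (hR : IsMarkerRule z R)
    (hz : X.IsSynchronizingWord z) (hL : ∀ r ∈ R, r.1 ∈ X.language) {N : ℕ}
    (hN : ∀ r ∈ R, r.1.length ≤ N) : ∃ g : X.Aut, X.Restricts (replaceAll R) g := by
  have hL' : ∀ r ∈ Prod.swap '' R, r.1 ∈ X.language := by
    rintro _ ⟨r, hr, rfl⟩
    obtain ⟨s, hs, h⟩ := hR.succ r hr
    exact (h ▸ hL s hs : r.2 ∈ X.language)
  have hN' : ∀ r ∈ Prod.swap '' R, r.1.length ≤ N := by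
    rintro _ ⟨r, hr, rfl⟩
    exact (hR.length_eq r hr).symm.trans_le (hN r hr)
  have hm := fun x (hx : x ∈ X.carrier) => hR.replaceAll_mem hz hL hN hx
  have hm' := fun x (hx : x ∈ X.carrier) => hR.swap.replaceAll_mem hz hL' hN' hx
  let g : X.carrier ≃ₜ X.carrier :=
    { toFun := fun x => ⟨replaceAll R x.1, hm x.1 x.2⟩
      invFun := fun x => ⟨replaceAll (Prod.swap '' R) x.1, hm' x.1 x.2⟩
      left_inv := fun x => Subtype.ext (hR.replaceAll_swap_replaceAll x.1)
      right_inv := fun x => Subtype.ext (hR.replaceAll_replaceAll_swap x.1)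
      continuous_toFun := continuous_of_local hm N fun x y i h => hR.replaceAll_congr hN h
      continuous_invFun := continuous_of_local hm' N fun x y i h =>
        hR.swap.replaceAll_congr hN' h }
  exact ⟨⟨g, Subshift.mem_aut_iff.2 fun x => Subtype.ext (hR.replaceAll_shiftMap x.1)⟩,
    fun x => rfl⟩

/-! ### Cyclic rules -/

section Cyclic

variable {A : Type*} {z : List A}

theorem mem_cyclicRule {L : List (List A)} {r : List A × List A} :
    r ∈ cyclicRule L ↔ ∃ (i : ℕ) (hi : i < L.length),
      r = (L[i], L[(i + 1) % L.length]'(Nat.mod_lt _ (by omega))) := by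
  show r ∈ L.zip (L.rotate 1) ↔ _
  rw [List.mem_iff_getElem]
  constructor
  · rintro ⟨i, hi, rfl⟩
    refine ⟨i, by simp at hi; omega, ?_⟩
    simp [List.getElem_rotate]
  · rintro ⟨i, hi, rfl⟩
    refine ⟨i, by simpa using hi, ?_⟩
    simp [List.getElem_rotate]

theorem mem_cyclicRule_pair {u v : List A} {r : List A × List A} :
    r ∈ cyclicRule [u, v] ↔ r = (u, v) ∨ r = (v, u) := by
  show r ∈ [u, v].zip ([u, v].rotate 1) ↔ _
  simp

theorem fst_mem_of_mem_cyclicRule {L : List (List A)} {r : List A × List A}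
    (hr : r ∈ cyclicRule L) : r.1 ∈ L :=
  (List.of_mem_zip (show (r.1, r.2) ∈ L.zip (L.rotate 1) from hr)).1

theorem snd_mem_of_mem_cyclicRule {L : List (List A)} {r : List A × List A}
    (hr : r ∈ cyclicRule L) : r.2 ∈ L := by
  have := (List.of_mem_zip (show (r.1, r.2) ∈ L.zip (L.rotate 1) from hr)).2
  rwa [List.mem_rotate] at this

theorem cyclicRule_fst_inj {L : List (List A)} (hL : L.Nodup) {r s : List A × List A}
    (hr : r ∈ cyclicRule L) (hs : s ∈ cyclicRule L) (h : r.1 = s.1) : r = s := by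
  obtain ⟨i, hi, rfl⟩ := mem_cyclicRule.1 hr
  obtain ⟨j, hj, rfl⟩ := mem_cyclicRule.1 hs
  obtain rfl : i = j := (hL.getElem_inj_iff).1 h
  rfl

theorem succ_mod_bijOn (n : ℕ) {k : ℕ} (hk : k < n) : ∃ i < n, (i + 1) % n = k := by
  rcases k with _ | k
  · exact ⟨n - 1, by omega, by rw [Nat.sub_add_cancel (by omega), Nat.mod_self]⟩
  · exact ⟨k, by omega, Nat.mod_eq_of_lt hk⟩

theorem succ_mod_inj {n i j : ℕ} (hi : i < n) (hj : j < n) (h : (i + 1) % n = (j + 1) % n) :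
    i = j := by
  have h' : i ≡ j [MOD n] := Nat.ModEq.add_right_cancel' 1 h
  rwa [Nat.ModEq, Nat.mod_eq_of_lt hi, Nat.mod_eq_of_lt hj] at h'

theorem cyclicRule_snd_inj {L : List (List A)} (hL : L.Nodup) {r s : List A × List A}
    (hr : r ∈ cyclicRule L) (hs : s ∈ cyclicRule L) (h : r.2 = s.2) : r = s := by
  obtain ⟨i, hi, rfl⟩ := mem_cyclicRule.1 hr
  obtain ⟨j, hj, rfl⟩ := mem_cyclicRule.1 hs
  obtain rfl : i = j := succ_mod_inj hi hj ((hL.getElem_inj_iff).1 h)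
  rfl

theorem exists_cyclicRule_fst {L : List (List A)} {w : List A} (hw : w ∈ L) :
    ∃ s ∈ cyclicRule L, s.1 = w := by
  obtain ⟨i, hi, rfl⟩ := List.mem_iff_getElem.1 hw
  exact ⟨_, mem_cyclicRule.2 ⟨i, hi, rfl⟩, rfl⟩

theorem exists_cyclicRule_snd {L : List (List A)} {w : List A} (hw : w ∈ L) :
    ∃ s ∈ cyclicRule L, s.2 = w := by
  obtain ⟨k, hk, rfl⟩ := List.mem_iff_getElem.1 hw
  obtain ⟨i, hi, rfl⟩ := succ_mod_bijOn _ hk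
  exact ⟨_, mem_cyclicRule.2 ⟨i, hi, rfl⟩, rfl⟩

/-- Cyclic permutations of words that overlap at most in a marker. -/
theorem isMarkerRule_iUnion {ι : Type*} {s : Set ι} {L : ι → List (List A)} (hz : 0 < z.length)
    (hnodup : ∀ i ∈ s, (L i).Nodup)
    (hlen : ∀ i ∈ s, ∀ u ∈ L i, ∀ v ∈ L i, u.length = v.length)
    (hbord : ∀ i ∈ s, ∀ u ∈ L i, ∃ m, u = z ++ m ++ z)
    (hover : ∀ (x : ℤ → A) (k l : ℤ), ∀ i ∈ s, ∀ j ∈ s, ∀ u ∈ L i, ∀ v ∈ L j, OccursAt x u k →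
      OccursAt x v l → k ≤ l → l + z.length < k + u.length → k = l ∧ i = j ∧ u = v) :
    IsMarkerRule z (⋃ i ∈ s, cyclicRule (L i)) where
  marker_pos := hz
  length_eq r hr := by
    simp only [Set.mem_iUnion] at hr
    obtain ⟨i, hi, hr⟩ := hr
    exact hlen i hi _ (fst_mem_of_mem_cyclicRule hr) _ (snd_mem_of_mem_cyclicRule hr)
  bordered r hr := by
    simp only [Set.mem_iUnion] at hr
    obtain ⟨i, hi, hr⟩ := hr
    exact hbord i hi _ (fst_mem_of_mem_cyclicRule hr)
  overlap x k l r hr t ht h h' hkl hlk := by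
    simp only [Set.mem_iUnion] at hr ht
    obtain ⟨i, hi, hr⟩ := hr
    obtain ⟨j, hj, ht⟩ := ht
    obtain ⟨h1, rfl, h3⟩ := hover x k l i hi j hj _ (fst_mem_of_mem_cyclicRule hr) _
      (fst_mem_of_mem_cyclicRule ht) h h' hkl hlk
    exact ⟨h1, cyclicRule_fst_inj (hnodup i hi) hr ht h3⟩
  injective r hr t ht h := by
    simp only [Set.mem_iUnion] at hr ht
    obtain ⟨i, hi, hr⟩ := hr
    obtain ⟨j, hj, ht⟩ := ht
    obtain ⟨m, hm⟩ := hbord i hi _ (snd_mem_of_mem_cyclicRule hr)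
    obtain ⟨x, hocc⟩ := exists_config_occursAt (w := r.2) (by rw [hm]; simp; omega)
    obtain ⟨-, rfl, -⟩ := hover _ 0 0 i hi j hj _ (snd_mem_of_mem_cyclicRule hr) _
      (snd_mem_of_mem_cyclicRule ht) hocc (h ▸ hocc) le_rfl (by rw [hm]; simp; omega)
    exact cyclicRule_snd_inj (hnodup i hi) hr ht h
  succ r hr := by
    simp only [Set.mem_iUnion] at hr
    obtain ⟨i, hi, hr⟩ := hr
    obtain ⟨t, ht, h⟩ := exists_cyclicRule_fst (snd_mem_of_mem_cyclicRule hr)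
    exact ⟨t, by simp only [Set.mem_iUnion]; exact ⟨i, hi, ht⟩, h⟩
  pred r hr := by
    simp only [Set.mem_iUnion] at hr
    obtain ⟨i, hi, hr⟩ := hr
    obtain ⟨t, ht, h⟩ := exists_cyclicRule_snd (fst_mem_of_mem_cyclicRule hr)
    exact ⟨t, by simp only [Set.mem_iUnion]; exact ⟨i, hi, ht⟩, h⟩

theorem isMarkerRule_pair {u v : List A} (hz : 0 < z.length) (huv : u ≠ v)
    (hlen : u.length = v.length) (hu : ∃ m, u = z ++ m ++ z) (hv : ∃ m, v = z ++ m ++ z)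
    (hover : ∀ (x : ℤ → A) (k l : ℤ), ∀ w ∈ [u, v], ∀ w' ∈ [u, v], OccursAt x w k →
      OccursAt x w' l → k ≤ l → l + z.length < k + u.length → k = l ∧ w = w') :
    IsMarkerRule z (cyclicRule [u, v]) := by
  have hl : ∀ w ∈ [u, v], w.length = u.length := by simp [hlen]
  have := isMarkerRule_iUnion (z := z) (s := Set.univ) (L := fun _ : Unit => [u, v]) hz
    (by simp [huv]) (fun _ _ w hw w' hw' => (hl w hw).trans (hl w' hw').symm)
    (by
      intro _ _ w hw
      rcases List.mem_pair.1 hw with rfl | rfl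
      exacts [hu, hv]) (fun x k l _ _ _ _ w hw w' hw' h h' hkl hlk => by
      obtain ⟨h1, h2⟩ := hover x k l w hw w' hw' h h' hkl (by rw [← hl w hw]; exact hlk)
      exact ⟨h1, rfl, h2⟩)
  simpa [Set.iUnion_const] using this

end Cyclic

/-! ### Powers of words and commuting words -/

section Words

variable {A : Type*} {z o w m : List A}

@[simp] theorem length_wpow (w : List A) (k : ℕ) : (wpow w k).length = k * w.length := by
  simp [wpow]

theorem wpow_zero (w : List A) : wpow w 0 = [] := rfl

theorem wpow_succ (w : List A) (k : ℕ) : wpow w (k + 1) = w ++ wpow w k := by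
  simp [wpow, List.replicate_succ]

theorem wpow_succ' (w : List A) (k : ℕ) : wpow w (k + 1) = wpow w k ++ w := by
  simp [wpow, List.replicate_succ']

theorem mem_of_mem_wpow {a : A} {k : ℕ} (h : a ∈ wpow w k) : a ∈ w := by
  simp only [wpow, List.mem_flatten, List.mem_replicate] at h
  obtain ⟨l, ⟨-, rfl⟩, h⟩ := h
  exact h

theorem not_mem_of_mem_wpow (ho : ∀ a ∈ z, a ∉ o) {k : ℕ} : ∀ a ∈ wpow o k, a ∉ z :=
  fun a ha haz => ho a haz (mem_of_mem_wpow ha)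

/-- Euclidean algorithm: of two commuting words the shorter is a prefix of the longer, and
cancelling it from `m` leaves a shorter word that still commutes with `z`. -/
theorem mem_of_append_comm : ∀ {m : List A}, 0 < z.length → m ++ z = z ++ m → ∀ a ∈ m, a ∈ z := by
  intro m
  induction hn : m.length using Nat.strong_induction_on generalizing m with
  | _ n ih =>
    intro hz h a ha
    rcases le_total m.length z.length with hl | hl
    · obtain ⟨t, rfl⟩ := List.prefix_of_prefix_length_le (List.prefix_append m z)
        (h ▸ List.prefix_append z m) hl
      simp [ha]
    · obtain ⟨t, rfl⟩ := List.prefix_of_prefix_length_le (List.prefix_append z m)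
        (h ▸ List.prefix_append m z) hl
      rw [List.append_assoc] at h
      have h' := List.append_cancel_left h
      rcases List.mem_append.1 ha with ha | ha
      · exact ha
      · exact ih t.length (by simp at hn; omega) rfl hz h' a ha

end Words

/-! ### Runs of marker letters and marker-free runs -/

section Runs

variable {A : Type*} {z w : List A} {x : ℤ → A}

/-- All letters of `x` on `[a, b)` belong to the marker. -/
def MarkerOn (z : List A) (x : ℤ → A) (a b : ℤ) : Prop := ∀ i, a ≤ i → i < b → x i ∈ z

/-- No letter of `x` on `[a, b)` belongs to the marker. -/
def MarkerFreeOn (z : List A) (x : ℤ → A) (a b : ℤ) : Prop := ∀ i, a ≤ i → i < b → x i ∉ z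

theorem MarkerOn.le_or_le {a b c d : ℤ} (h : MarkerOn z x a b) (h' : MarkerFreeOn z x c d)
    (hab : a < b) (hcd : c < d) : b ≤ c ∨ d ≤ a := by
  by_contra hn
  exact h' (max a c) (le_max_right _ _) (by omega) (h (max a c) (le_max_left _ _) (by omega))

theorem OccursAt.markerOn {k l : ℤ} (h : OccursAt x w k) (hw : ∀ a ∈ w, a ∈ z)
    (hl : l = k + w.length) : MarkerOn z x k l :=
  fun _ hi hi' => hw _ (h.mem hi (hl ▸ hi'))

theorem OccursAt.markerFreeOn {k l : ℤ} (h : OccursAt x w k) (hw : ∀ a ∈ w, a ∉ z)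
    (hl : l = k + w.length) : MarkerFreeOn z x k l :=
  fun _ hi hi' => hw _ (h.mem hi (hl ▸ hi'))

theorem OccursAt.run {a c : ℕ} {u : List A} {k : ℤ}
    (h : OccursAt x (wpow z a ++ u ++ wpow z c) k) (hu : ∀ a ∈ u, a ∉ z) :
    MarkerOn z x k (k + a * z.length) ∧
    MarkerFreeOn z x (k + a * z.length) (k + a * z.length + u.length) ∧
    MarkerOn z x (k + a * z.length + u.length) (k + a * z.length + u.length + c * z.length) := by
  simp only [occursAt_append, List.length_append, length_wpow] at h
  obtain ⟨⟨h1, h2⟩, h3⟩ := h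
  refine ⟨h1.markerOn (fun _ => mem_of_mem_wpow) (by simp), ?_, ?_⟩
  · convert h2.markerFreeOn hu rfl using 1 <;> (push_cast; ring)
  · convert h3.markerOn (fun _ => mem_of_mem_wpow) rfl using 1
    · push_cast; ring
    · simp; ring

theorem OccursAt.runs {a b c : ℕ} {u v : List A} {k : ℤ}
    (h : OccursAt x (wpow z a ++ u ++ wpow z b ++ v ++ wpow z c) k) (hu : ∀ a ∈ u, a ∉ z)
    (hv : ∀ a ∈ v, a ∉ z) :
    MarkerOn z x k (k + a * z.length) ∧
    MarkerFreeOn z x (k + a * z.length) (k + a * z.length + u.length) ∧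
    MarkerOn z x (k + a * z.length + u.length) (k + a * z.length + u.length + b * z.length) ∧
    MarkerFreeOn z x (k + a * z.length + u.length + b * z.length)
      (k + a * z.length + u.length + b * z.length + v.length) ∧
    MarkerOn z x (k + a * z.length + u.length + b * z.length + v.length)
      (k + a * z.length + u.length + b * z.length + v.length + c * z.length) := by
  rw [occursAt_append, occursAt_append] at h
  obtain ⟨⟨h1, h2⟩, h3⟩ := h
  obtain ⟨h4, h5, h6⟩ := h1.run hu
  simp only [List.length_append, length_wpow] at h2 h3
  refine ⟨h4, h5, h6, ?_, ?_⟩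
  · convert h2.markerFreeOn hv rfl using 1 <;> (push_cast; ring)
  · convert h3.markerOn (fun _ => mem_of_mem_wpow) rfl using 1
    · push_cast; ring
    · simp; ring

variable {p k b e b₂ e₂ f k' b' e' b₂' e₂' f' : ℤ}

/-- Since the two kinds of runs are disjoint, the marker-free runs either coincide or miss each
other. In the latter case the overlap lies in the last marker run of the first word and the first
marker run of the second, and `hf` bounds one of these by `p`. -/
theorem run_eq_run (hp : 0 < p) (h1 : MarkerOn z x k b) (h2 : MarkerFreeOn z x b e)
    (h3 : MarkerOn z x e f) (h1' : MarkerOn z x k' b') (h2' : MarkerFreeOn z x b' e')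
    (h3' : MarkerOn z x e' f') (hk : k + p ≤ b) (hb : b < e) (he : e + p ≤ f)
    (hk' : k' + p ≤ b') (hb' : b' < e') (he' : e' + p ≤ f') (hkk : k ≤ k') (hkf : k' + p < f)
    (hf : f = e + p ∨ b' = k' + p) : b = b' ∧ e = e' := by
  have d1 := h1.le_or_le h2' (by omega) hb'
  have d2 := h3.le_or_le h2' (by omega) hb'
  have d3 := h1'.le_or_le h2 (by omega) hb
  have d4 := h3'.le_or_le h2 (by omega) hb
  omega

/-- Words with two marker-free runs whose first run cannot be a second run. -/
theorem runs_eq_runs (hp : 0 < p) (h1 : MarkerOn z x k b) (h2 : MarkerFreeOn z x b e)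
    (h3 : MarkerOn z x e b₂) (h4 : MarkerFreeOn z x b₂ e₂) (h5 : MarkerOn z x e₂ f)
    (h1' : MarkerOn z x k' b') (h2' : MarkerFreeOn z x b' e') (h3' : MarkerOn z x e' b₂')
    (h4' : MarkerFreeOn z x b₂' e₂') (h5' : MarkerOn z x e₂' f')
    (hk : k + p ≤ b) (hb : b < e) (he : e + p ≤ b₂) (hb₂ : b₂ < e₂) (he₂ : e₂ + p ≤ f)
    (hk' : k' + p ≤ b') (hb' : b' < e') (he' : e' + p ≤ b₂') (hb₂' : b₂' < e₂')
    (he₂' : e₂' + p ≤ f') (hkk : k ≤ k') (hkf : k' + p < f)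
    (hf : f = e₂ + p ∨ b' = k' + p) (hne : e' - b' ≠ e₂ - b₂ ∨ b₂ - e < b' - k') :
    b = b' ∧ e = e' ∧ b₂ = b₂' ∧ e₂ = e₂' := by
  have hbb : b = b' ∧ e = e' := by
    have d1 := h1.le_or_le h2' (by omega) hb'
    have d2 := h3.le_or_le h2' (by omega) hb'
    have d3 := h5.le_or_le h2' (by omega) hb'
    have d4 := h1'.le_or_le h2 (by omega) hb
    have d5 := h3'.le_or_le h2 (by omega) hb
    have d6 := h1'.le_or_le h4 (by omega) hb₂
    have d7 := h3'.le_or_le h4 (by omega) hb₂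
    omega
  obtain ⟨rfl, rfl⟩ := hbb
  have d1 := h3.le_or_le h4' (by omega) hb₂'
  have d2 := h5.le_or_le h4' (by omega) hb₂'
  have d3 := h3'.le_or_le h4 (by omega) hb₂
  have d4 := h5'.le_or_le h4 (by omega) hb₂
  omega

/-- The single run of the second word cannot be the second run of the first word: by `hlt` the
marker run that precedes it does not fit into the gap. -/
theorem run_eq_fst_run (hp : 0 < p) (h1 : MarkerOn z x k b) (h2 : MarkerFreeOn z x b e)
    (h3 : MarkerOn z x e b₂) (h4 : MarkerFreeOn z x b₂ e₂) (h5 : MarkerOn z x e₂ f)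
    (h1' : MarkerOn z x k' b') (h2' : MarkerFreeOn z x b' e') (h3' : MarkerOn z x e' f')
    (hk : k + p ≤ b) (hb : b < e) (he : e + p ≤ b₂) (hb₂ : b₂ < e₂) (he₂ : f = e₂ + p)
    (hk' : k' + p ≤ b') (hb' : b' < e') (he' : f' = e' + p)
    (hkk : k ≤ k' ∧ k' + p < f ∨ k' ≤ k ∧ k + p < f')
    (hlt : b₂ - e < b' - k') : b = b' ∧ e = e' := by
  have d1 := h1.le_or_le h2' (by omega) hb'
  have d2 := h3.le_or_le h2' (by omega) hb'
  have d3 := h5.le_or_le h2' (by omega) hb'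
  have d4 := h1'.le_or_le h2 (by omega) hb
  have d5 := h3'.le_or_le h2 (by omega) hb
  have d6 := h1'.le_or_le h4 (by omega) hb₂
  have d7 := h3'.le_or_le h4 (by omega) hb₂
  omega

end Runs

/-! ### Words between two markers -/

section Return

variable {A : Type*} [TopologicalSpace A] {X : Subshift A} {z o : List A}

/-- The words that may stand between two markers. -/
def Subshift.IsReturn (X : Subshift A) (z w : List A) : Prop := z ++ w ++ z ∈ X.language

theorem Subshift.IsReturn.append (hz : X.IsSynchronizingWord z) {u v : List A}
    (hu : X.IsReturn z u) (hv : X.IsReturn z v) : X.IsReturn z (u ++ z ++ v) := by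
  have hu' : z ++ u ∈ X.language := left_mem_language hu
  have hv' : v ++ z ∈ X.language := by
    have : z ++ (v ++ z) ∈ X.language := by simpa [IsReturn] using hv
    exact right_mem_language this
  have := hz.2 _ hu' _ hv' hu (by simpa [IsReturn] using hv)
  simpa [IsReturn] using this

namespace Subshift.IsMarkerPair

variable (h : X.IsMarkerPair z o)
include h

theorem length_pos : 0 < z.length := List.length_pos_of_ne_nil h.z_ne_nil

theorem length_pos' : 0 < o.length := by have := h.two_le_length; omega

theorem isReturn_wpow (k : ℕ) : X.IsReturn z (wpow o k) := h.z_pow_z_mem k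

theorem isReturn_nil : X.IsReturn z [] := h.isReturn_wpow 0

theorem isReturn_self : X.IsReturn z o := by simpa [wpow] using h.isReturn_wpow 1

theorem isReturn_wpow_append {w : List A} (hw : X.IsReturn z w) (k : ℕ) :
    X.IsReturn z (wpow z k ++ w) := by
  induction k with
  | zero => simpa [wpow_zero] using hw
  | succ k ih =>
    rw [wpow_succ, List.append_assoc]
    exact h.isReturn_nil.append h.z_synchronizing ih

theorem isReturn_append_wpow {w : List A} (hw : X.IsReturn z w) (k : ℕ) :
    X.IsReturn z (w ++ wpow z k) := by
  induction k with
  | zero => simpa [wpow_zero] using hw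
  | succ k ih =>
    rw [wpow_succ', ← List.append_assoc]
    simpa using ih.append h.z_synchronizing h.isReturn_nil

theorem isReturn_mid {u v : List A} (hu : X.IsReturn z u) (hv : X.IsReturn z v) {k : ℕ}
    (hk : 0 < k) : X.IsReturn z (u ++ wpow z k ++ v) := by
  obtain ⟨k, rfl⟩ := Nat.exists_eq_succ_of_ne_zero hk.ne'
  rw [wpow_succ, ← List.append_assoc, List.append_assoc _ (wpow z k)]
  exact hu.append h.z_synchronizing (h.isReturn_wpow_append hv k)

theorem mem_language_runs {u v : List A} {a b c : ℕ} (hu : X.IsReturn z u)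
    (hv : X.IsReturn z v) (ha : 0 < a) (hb : 0 < b) (hc : 0 < c) :
    wpow z a ++ u ++ wpow z b ++ v ++ wpow z c ∈ X.language := by
  obtain ⟨a, rfl⟩ := Nat.exists_eq_succ_of_ne_zero ha.ne'
  obtain ⟨c, rfl⟩ := Nat.exists_eq_succ_of_ne_zero hc.ne'
  have := h.isReturn_append_wpow (h.isReturn_wpow_append (h.isReturn_mid hu hv hb) a) c
  simpa [IsReturn, wpow_succ z a, wpow_succ' z c] using this

theorem mem_language_run {u : List A} {a c : ℕ} (hu : X.IsReturn z u)
    (ha : 0 < a) (hc : 0 < c) : wpow z a ++ u ++ wpow z c ∈ X.language := by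
  obtain ⟨a, rfl⟩ := Nat.exists_eq_succ_of_ne_zero ha.ne'
  obtain ⟨c, rfl⟩ := Nat.exists_eq_succ_of_ne_zero hc.ne'
  have := h.isReturn_append_wpow (h.isReturn_wpow_append hu a) c
  simpa [IsReturn, wpow_succ z a, wpow_succ' z c] using this

end Subshift.IsMarkerPair

end Return

theorem exists_bordered {A : Type*} (z u : List A) {a c : ℕ} (ha : 0 < a) (hc : 0 < c) :
    ∃ m, wpow z a ++ u ++ wpow z c = z ++ m ++ z := by
  obtain ⟨a, rfl⟩ := Nat.exists_eq_succ_of_ne_zero ha.ne'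
  obtain ⟨c, rfl⟩ := Nat.exists_eq_succ_of_ne_zero hc.ne'
  exact ⟨wpow z a ++ u ++ wpow z c, by simp [wpow_succ z a, wpow_succ' z c]⟩

/-- A bounded marker rule with words of the language, none of which consists of letters of the
marker only. -/
structure IsBoundedRule {A : Type*} [TopologicalSpace A] (X : Subshift A) (z : List A) (N : ℕ)
    (R : Set (List A × List A)) : Prop extends IsMarkerRule z R where
  mem_language : ∀ r ∈ R, r.1 ∈ X.language
  length_le : ∀ r ∈ R, r.1.length ≤ N
  exists_not_mem : ∀ r ∈ R, ∃ a ∈ r.1, a ∉ z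

/-! ### The rules of `P₁`, `P₂`, `F₁` and `F₂` -/

namespace Subshift.IsMarkerPair

variable {A : Type*} [TopologicalSpace A] {X : Subshift A} {z o : List A}

/-- The exchange of two words with one marker-free run each. -/
theorem isBoundedRule_run (h : X.IsMarkerPair z o) {u v : List A} {a c a' c' : ℕ}
    (hu : ∀ b ∈ u, b ∉ z) (hv : ∀ b ∈ v, b ∉ z) (hu' : X.IsReturn z u) (hv' : X.IsReturn z v)
    (ha : 0 < a) (hc : 0 < c) (ha' : 0 < a') (hc' : 0 < c') (hu0 : 0 < u.length)
    (hv0 : 0 < v.length) (hlen : a * z.length + u.length + c * z.length =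
      a' * z.length + v.length + c' * z.length) (huv : u.length ≠ v.length)
    (h1 : a = 1 ∧ a' = 1 ∨ c = 1 ∧ c' = 1) :
    IsBoundedRule X z (a * z.length + u.length + c * z.length)
      (cyclicRule [wpow z a ++ u ++ wpow z c, wpow z a' ++ v ++ wpow z c']) := by
  have hp := h.length_pos
  have e1 := Nat.le_mul_of_pos_left z.length ha
  have e2 := Nat.le_mul_of_pos_left z.length hc
  have e3 := Nat.le_mul_of_pos_left z.length ha'
  have e4 := Nat.le_mul_of_pos_left z.length hc'
  -- Stated for arbitrary `s` and `t` to serve all four ordered pairs of words; `n = 1 ∨ m' = 1`,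
  -- which follows from `h1`, is the condition `hf` of `run_eq_run`.
  have key : ∀ {x : ℤ → A} {k l : ℤ} {s t : List A} {m n m' n' : ℕ}, (∀ b ∈ s, b ∉ z) →
      (∀ b ∈ t, b ∉ z) → 0 < s.length → 0 < t.length → z.length ≤ m * z.length →
      z.length ≤ n * z.length → z.length ≤ m' * z.length → z.length ≤ n' * z.length →
      n = 1 ∨ m' = 1 → OccursAt x (wpow z m ++ s ++ wpow z n) k →
      OccursAt x (wpow z m' ++ t ++ wpow z n') l → k ≤ l →
      l + z.length < k + (m * z.length + s.length + n * z.length : ℕ) →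
      k + m * z.length = l + m' * z.length ∧ s.length = t.length := by
    intro x k l s t m n m' n' hs ht hs0 ht0 f1 f2 f3 f4 hnm h1 h2 hkl hlk
    obtain ⟨i1, i2, i3⟩ := h1.run hs
    obtain ⟨j1, j2, j3⟩ := h2.run ht
    have := run_eq_run (p := z.length) (by omega) i1 i2 i3 j1 j2 j3 (by linarith)
      (by omega) (by linarith) (by linarith) (by omega) (by linarith) hkl (by push_cast at hlk ⊢; linarith) (by
        rcases hnm with rfl | rfl
        · left; simp
        · right; simp)
    exact ⟨this.1, by omega⟩
  have hl1 : (wpow z a ++ u ++ wpow z c).length = a * z.length + u.length + c * z.length := by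
    simp [add_assoc]
  have hl2 : (wpow z a' ++ v ++ wpow z c').length = a * z.length + u.length + c * z.length := by
    rw [hlen]; simp [add_assoc]
  refine ⟨isMarkerRule_pair hp (fun he => ?_) (hl1.trans hl2.symm) (exists_bordered z u ha hc)
    (exists_bordered z v ha' hc') ?_, ?_, ?_, ?_⟩
  · obtain ⟨x, hx⟩ := exists_config_occursAt (w := wpow z a ++ u ++ wpow z c) (by omega)
    exact huv (key hu hv hu0 hv0 (by omega) (by omega) (by omega) (by omega) (by omega) hx
      (he ▸ hx) le_rfl (by push_cast; omega)).2
  · intro x k l w hw w' hw' hk hl hkl hlk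
    rw [hl1] at hlk
    rcases List.mem_pair.1 hw with rfl | rfl <;> rcases List.mem_pair.1 hw' with rfl | rfl
    · have := key hu hu hu0 hu0 (by omega) (by omega) (by omega) (by omega) (by omega) hk hl hkl hlk
      exact ⟨by omega, rfl⟩
    · have := key hu hv hu0 hv0 (by omega) (by omega) (by omega) (by omega) (by omega) hk hl hkl hlk
      exact absurd this.2 huv
    · have := key hv hu hv0 hu0 (by omega) (by omega) (by omega) (by omega) (by omega) hk hl hkl
        (hlen ▸ hlk)
      exact absurd this.2.symm huv
    · have := key hv hv hv0 hv0 (by omega) (by omega) (by omega) (by omega) (by omega) hk hl hkl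
        (hlen ▸ hlk)
      exact ⟨by omega, rfl⟩
  · intro r hr
    rcases List.mem_pair.1 (fst_mem_of_mem_cyclicRule hr) with hr | hr <;> rw [hr]
    exacts [h.mem_language_run hu' ha hc, h.mem_language_run hv' ha' hc']
  · intro r hr
    rcases List.mem_pair.1 (fst_mem_of_mem_cyclicRule hr) with hr | hr <;> rw [hr]
    exacts [hl1.le, hl2.le]
  · intro r hr
    obtain ⟨b, hb⟩ := List.exists_mem_of_length_pos hu0
    obtain ⟨b', hb'⟩ := List.exists_mem_of_length_pos hv0
    rcases List.mem_pair.1 (fst_mem_of_mem_cyclicRule hr) with hr | hr <;> rw [hr]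
    exacts [⟨b, by simp [hb], hu b hb⟩, ⟨b', by simp [hb'], hv b' hb'⟩]

/-- The exchange of two words with the same two marker-free runs at different distances. -/
theorem isBoundedRule_runs (h : X.IsMarkerPair z o) {u v : List A} {a b c a' b' c' : ℕ}
    (hu : ∀ b ∈ u, b ∉ z) (hv : ∀ b ∈ v, b ∉ z) (hu' : X.IsReturn z u) (hv' : X.IsReturn z v)
    (ha : 0 < a) (hb : 0 < b) (hc : 0 < c) (ha' : 0 < a') (hb' : 0 < b') (hc' : 0 < c')
    (hu0 : 0 < u.length) (hv0 : 0 < v.length) (hlen : a + b + c = a' + b' + c')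
    (huv : u.length ≠ v.length) (hbb : b ≠ b') (h1 : a = 1 ∧ a' = 1 ∨ c = 1 ∧ c' = 1) :
    IsBoundedRule X z ((a + b + c) * z.length + u.length + v.length)
      (cyclicRule [wpow z a ++ u ++ wpow z b ++ v ++ wpow z c,
        wpow z a' ++ u ++ wpow z b' ++ v ++ wpow z c']) := by
  have hp := h.length_pos
  have key : ∀ {x : ℤ → A} {k l : ℤ} {a b c a' b' c' : ℕ}, 0 < a → 0 < b → 0 < c → 0 < a' →
      0 < b' → 0 < c' → c = 1 ∨ a' = 1 → OccursAt x (wpow z a ++ u ++ wpow z b ++ v ++ wpow z c) k →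
      OccursAt x (wpow z a' ++ u ++ wpow z b' ++ v ++ wpow z c') l → k ≤ l →
      l + z.length < k + ((a + b + c) * z.length + u.length + v.length : ℕ) →
      k + a * z.length = l + a' * z.length ∧ b = b' := by
    intro x k l a b c a' b' c' ha hb hc ha' hb' hc' hnm h1 h2 hkl hlk
    obtain ⟨i1, i2, i3, i4, i5⟩ := h1.runs hu hv
    obtain ⟨j1, j2, j3, j4, j5⟩ := h2.runs hu hv
    have e1 : (z.length : ℤ) ≤ a * z.length := by exact_mod_cast Nat.le_mul_of_pos_left _ ha
    have e2 : (z.length : ℤ) ≤ b * z.length := by exact_mod_cast Nat.le_mul_of_pos_left _ hb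
    have e3 : (z.length : ℤ) ≤ c * z.length := by exact_mod_cast Nat.le_mul_of_pos_left _ hc
    have e4 : (z.length : ℤ) ≤ a' * z.length := by exact_mod_cast Nat.le_mul_of_pos_left _ ha'
    have e5 : (z.length : ℤ) ≤ b' * z.length := by exact_mod_cast Nat.le_mul_of_pos_left _ hb'
    have e6 : (z.length : ℤ) ≤ c' * z.length := by exact_mod_cast Nat.le_mul_of_pos_left _ hc'
    have := runs_eq_runs (p := z.length) (by omega) i1 i2 i3 i4 i5 j1 j2 j3 j4 j5 (by linarith)
      (by omega) (by linarith) (by omega) (by linarith) (by linarith) (by omega) (by linarith)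
      (by omega) (by linarith) hkl (by push_cast at hlk ⊢; linarith) (by
        rcases hnm with rfl | rfl
        · left; simp
        -- The runs `u` and `v` differ in length, so a first run is never a second run.
        · right; simp) (Or.inl (by omega))
    refine ⟨this.1, ?_⟩
    have h3 : (b : ℤ) * z.length = b' * z.length := by linarith [this.2.1, this.2.2.1]
    exact_mod_cast mul_right_cancel₀ (by omega) h3
  have hlg : ∀ a b c, (wpow z a ++ u ++ wpow z b ++ v ++ wpow z c).length =
      (a + b + c) * z.length + u.length + v.length := fun a b c => by
    simp only [List.length_append, length_wpow]; ring
  have hl1 := hlg a b c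
  have hl2 := hlg a' b' c'
  rw [← hlen] at hl2
  refine ⟨isMarkerRule_pair hp (fun he => ?_) (hl1.trans hl2.symm) ?_ ?_ ?_, ?_, ?_, ?_⟩
  · obtain ⟨x, hx⟩ := exists_config_occursAt (w := wpow z a ++ u ++ wpow z b ++ v ++ wpow z c)
      (by rw [hl1]; omega)
    have := Nat.le_mul_of_pos_left z.length (n := a + b + c) (by omega)
    exact hbb (key ha hb hc ha' hb' hc' (by omega) hx (he ▸ hx) le_rfl (by omega)).2
  · obtain ⟨m, hm⟩ := exists_bordered z (u ++ wpow z b ++ v) ha hc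
    exact ⟨m, by simpa using hm⟩
  · obtain ⟨m, hm⟩ := exists_bordered z (u ++ wpow z b' ++ v) ha' hc'
    exact ⟨m, by simpa using hm⟩
  · intro x k l w hw w' hw' hk hl hkl hlk
    rw [hl1] at hlk
    rcases List.mem_pair.1 hw with rfl | rfl <;> rcases List.mem_pair.1 hw' with rfl | rfl
    · have := key ha hb hc ha hb hc (by omega) hk hl hkl hlk
      exact ⟨by omega, rfl⟩
    · exact absurd (key ha hb hc ha' hb' hc' (by omega) hk hl hkl hlk).2 hbb
    · exact absurd (key ha' hb' hc' ha hb hc (by omega) hk hl hkl (hlen ▸ hlk)).2.symm hbb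
    · have := key ha' hb' hc' ha' hb' hc' (by omega) hk hl hkl (hlen ▸ hlk)
      exact ⟨by omega, rfl⟩
  · intro r hr
    rcases List.mem_pair.1 (fst_mem_of_mem_cyclicRule hr) with hr | hr <;> rw [hr]
    exacts [h.mem_language_runs hu' hv' ha hb hc, h.mem_language_runs hu' hv' ha' hb' hc']
  · intro r hr
    rcases List.mem_pair.1 (fst_mem_of_mem_cyclicRule hr) with hr | hr <;> rw [hr]
    exacts [hl1.le, hl2.le]
  · intro r hr
    obtain ⟨b, hb⟩ := List.exists_mem_of_length_pos hu0
    rcases List.mem_pair.1 (fst_mem_of_mem_cyclicRule hr) with hr | hr <;> rw [hr] <;>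
    exact ⟨b, by simp [hb], hu b hb⟩

variable (h : X.IsMarkerPair z o)
include h

theorem not_mem_z : ∀ a ∈ o, a ∉ z := fun a ha haz => h.not_mem_o a haz ha

/-- Tells the runs `o` and `o^(p+1)` apart by their lengths. -/
theorem length_lt_mul : o.length < (z.length + 1) * o.length := by
  nlinarith [h.length_pos, h.length_pos']

theorem isBoundedRule_P1 : ∃ N, IsBoundedRule X z N (cyclicRule
    [z ++ (wpow z o.length ++ o) ++ z, z ++ wpow o (z.length + 1) ++ z]) := by
  have hlt := h.length_lt_mul
  have := h.isBoundedRule_run (u := o) (v := wpow o (z.length + 1)) (a := o.length + 1) (c := 1)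
    (a' := 1) (c' := 1) h.not_mem_z (not_mem_of_mem_wpow h.not_mem_o) h.isReturn_self
    (h.isReturn_wpow _) (by omega) (by omega) (by omega) (by omega) h.length_pos'
    (by simp [h.length_pos']) (by rw [length_wpow]; ring) (by rw [length_wpow]; omega) (by omega)
  exact ⟨_, by simpa [wpow_succ, wpow_zero] using this⟩

theorem isBoundedRule_P2 : ∃ N, IsBoundedRule X z N (cyclicRule
    [z ++ wpow o (z.length + 1) ++ z, z ++ (o ++ wpow z o.length) ++ z]) := by
  have hlt := h.length_lt_mul
  have := h.isBoundedRule_run (u := wpow o (z.length + 1)) (v := o) (a := 1) (c := 1)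
    (a' := 1) (c' := o.length + 1) (not_mem_of_mem_wpow h.not_mem_o) h.not_mem_z
    (h.isReturn_wpow _) h.isReturn_self (by omega) (by omega) (by omega) (by omega)
    (by simp [h.length_pos']) h.length_pos' (by rw [length_wpow]; ring)
    (by rw [length_wpow]; omega) (by omega)
  exact ⟨_, by simpa [wpow_succ _ 0, wpow_succ' z o.length, wpow_zero] using this⟩

theorem isBoundedRule_F1 : ∃ N, IsBoundedRule X z N (cyclicRule
    [z ++ gliderR z o ++ z ++ z ++ z ++ gliderL z o ++ z,
     z ++ gliderR z o ++ z ++ z ++ gliderL z o ++ z ++ z]) := by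
  have hlt := h.length_lt_mul
  have := h.isBoundedRule_runs (u := wpow o (z.length + 1)) (v := o) (a := 1)
    (b := o.length + 3) (c := 1) (a' := 1) (b' := o.length + 2) (c' := 2)
    (not_mem_of_mem_wpow h.not_mem_o) h.not_mem_z
    (h.isReturn_wpow _) h.isReturn_self (by omega) (by omega) (by omega) (by omega) (by omega)
    (by omega) (by simp [h.length_pos']) h.length_pos' (by omega)
    (by rw [length_wpow]; omega) (by omega) (by omega)
  exact ⟨_, by simpa [wpow_succ, wpow_zero, gliderL, gliderR] using this⟩

theorem isBoundedRule_F2 : ∃ N, IsBoundedRule X z N (cyclicRule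
    [z ++ gliderR z o ++ z ++ z ++ gliderL z o ++ z,
     z ++ z ++ gliderR z o ++ z ++ gliderL z o ++ z]) := by
  have hlt := h.length_lt_mul
  have := h.isBoundedRule_runs (u := wpow o (z.length + 1)) (v := o) (a := 1)
    (b := o.length + 2) (c := 1) (a' := 2) (b' := o.length + 1) (c' := 1)
    (not_mem_of_mem_wpow h.not_mem_o) h.not_mem_z
    (h.isReturn_wpow _) h.isReturn_self (by omega) (by omega) (by omega) (by omega) (by omega)
    (by omega) (by simp [h.length_pos']) h.length_pos' (by omega)
    (by rw [length_wpow]; omega) (by omega) (by omega)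
  exact ⟨_, by simpa [wpow_succ, wpow_zero, gliderL, gliderR] using this⟩

end Subshift.IsMarkerPair

/-! ### The residue classes of the word lengths -/

section Classes

theorem numClasses_mul_gcd {A : Type*} (z o : List A) :
    numClasses z o * Nat.gcd z.length o.length = z.length :=
  Nat.div_mul_cancel (Nat.gcd_dvd_left _ _)

/-- With `p = (p/K) K`, dividing by `K` leaves a congruence of `i` and `j` modulo `p/K`, and the
range `1, …, p/K` meets each residue once. -/
theorem class_unique {A : Type*} {z o : List A} (hz : 0 < z.length) {i j n : ℕ}
    (hi : i ∈ Set.Icc 1 (numClasses z o)) (hj : j ∈ Set.Icc 1 (numClasses z o))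
    (h : n ≡ (i + 1) * Nat.gcd z.length o.length [MOD z.length])
    (h' : n ≡ (j + 1) * Nat.gcd z.length o.length [MOD z.length]) : i = j := by
  have hK := Nat.gcd_pos_of_pos_left o.length hz
  have h1 := h.symm.trans h'
  have h2 : (i + 1) * Nat.gcd z.length o.length ≡ (j + 1) * Nat.gcd z.length o.length
      [MOD numClasses z o * Nat.gcd z.length o.length] := by rwa [numClasses_mul_gcd]
  have h3 := Nat.ModEq.add_right_cancel' 1 (Nat.ModEq.mul_right_cancel' hK.ne' h2)
  obtain ⟨hi1, hi2⟩ := hi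
  obtain ⟨hj1, hj2⟩ := hj
  exact h3.eq_of_abs_lt (by rw [abs_lt]; omega)

/-- As `(p/K + 1) K = p + K` and `q ≡ K`, the word `o` can only compete in the class where it is
left out. -/
theorem class_eq_numClasses {A : Type*} {z o : List A} (hz : 0 < z.length) {j : ℕ}
    (hj : j ∈ Set.Icc 1 (numClasses z o))
    (h : o.length ≡ (j + 1) * Nat.gcd z.length o.length [MOD z.length])
    (ho : o.length ≡ Nat.gcd z.length o.length [MOD z.length]) : j = numClasses z o := by
  refine class_unique hz hj ⟨hj.1.trans hj.2, le_rfl⟩ h (ho.trans ?_)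
  rw [add_mul, one_mul, numClasses_mul_gcd]
  simp [Nat.ModEq]

end Classes

/-! ### The rule of `P₄` -/

namespace Subshift.IsMarkerPair

variable {A : Type*} [TopologicalSpace A] {X : Subshift A} {z o : List A} {n : ℕ}

theorem cycle_head (c : GliderChoice z o X n) (j : ℕ) :
    wpow z (c.padU j) ++ wordU z o j ++ z =
      wpow z (c.padU j) ++ o ++ wpow z o.length ++ wpow o j ++ wpow z 1 := by
  simp [wordU, wpow_succ _ 0, wpow_zero]

theorem cycle_tail (c : GliderChoice z o X n) (j : ℕ) (w : List A) :
    wpow z (c.pad j w) ++ w ++ z = wpow z (c.pad j w) ++ w ++ wpow z 1 := by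
  simp [wpow_succ _ 0, wpow_zero]

variable (h : X.IsMarkerPair z o) (c : GliderChoice z o X n) {x : ℤ → A} {i j : ℕ} {k l : ℤ}
  {u v : List A}
include h

theorem cycle_overlap_head_head (hi : i ∈ Set.Icc 1 (numClasses z o))
    (hj : j ∈ Set.Icc 1 (numClasses z o))
    (hk : OccursAt x (wpow z (c.padU i) ++ wordU z o i ++ z) k)
    (hl : OccursAt x (wpow z (c.padU j) ++ wordU z o j ++ z) l) (hkl : k ≤ l)
    (hlk : l + z.length < k + (wpow z (c.padU i) ++ wordU z o i ++ z).length) :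
    k = l ∧ i = j := by
  have hp := h.length_pos
  have hq := h.length_pos'
  rw [cycle_head] at hk hl hlk
  simp only [List.length_append, length_wpow, Nat.cast_add, Nat.cast_mul, one_mul] at hlk
  obtain ⟨i1, i2, i3, i4, i5⟩ := hk.runs h.not_mem_z (not_mem_of_mem_wpow h.not_mem_o)
  obtain ⟨j1, j2, j3, j4, j5⟩ := hl.runs h.not_mem_z (not_mem_of_mem_wpow h.not_mem_o)
  have e1 : ((o.length : ℤ) + 1) * z.length ≤ c.padU i * z.length := by
    exact_mod_cast Nat.mul_le_mul_right _ (c.le_padU i hi.1 hi.2)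
  have e2 : ((o.length : ℤ) + 1) * z.length ≤ c.padU j * z.length := by
    exact_mod_cast Nat.mul_le_mul_right _ (c.le_padU j hj.1 hj.2)
  have e3 : (z.length : ℤ) ≤ o.length * z.length := by
    exact_mod_cast Nat.le_mul_of_pos_left _ hq
  have e4 : (o.length : ℤ) ≤ i * o.length := by exact_mod_cast Nat.le_mul_of_pos_left _ hi.1
  have e5 : (o.length : ℤ) ≤ j * o.length := by exact_mod_cast Nat.le_mul_of_pos_left _ hj.1
  simp only [length_wpow, Nat.cast_mul, Nat.cast_one, one_mul, add_mul] at *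
  have := runs_eq_runs (p := z.length) (by omega) i1 i2 i3 i4 i5 j1 j2 j3 j4 j5 (by linarith)
    (by omega) (by linarith) (by omega) (by linarith) (by linarith) (by omega) (by linarith)
    -- The gap between the two runs is `z^q`, while each word begins with at least `q + 1` markers.
    (by omega) (by linarith) hkl (by linarith) (Or.inl rfl) (Or.inr (by linarith))
  obtain ⟨h1, -, h3, h4⟩ := this
  have h5 : (i : ℤ) * o.length = j * o.length := by linarith
  have hij : i = j := by exact_mod_cast mul_right_cancel₀ (by omega) h5
  subst hij
  exact ⟨by linarith, rfl⟩

/-- The run `v` could only be the first run of `u'_i`, which is `o`. Then `v = o`, so `j = p/K`,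
where `o` is excluded. -/
theorem cycle_no_overlap_head_tail (hi : i ∈ Set.Icc 1 (numClasses z o))
    (hj : j ∈ Set.Icc 1 (numClasses z o)) (hw : v ∈ c.words j)
    (hk : OccursAt x (wpow z (c.padU i) ++ wordU z o i ++ z) k)
    (hl : OccursAt x (wpow z (c.pad j v) ++ v ++ z) l)
    (hkl : k ≤ l ∧ l + z.length < k + (wpow z (c.padU i) ++ wordU z o i ++ z).length ∨
      l ≤ k ∧ k + z.length < l + (wpow z (c.pad j v) ++ v ++ z).length) : False := by
  have hp := h.length_pos
  have hq := h.length_pos'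
  obtain ⟨w1, w2, w3, w4, w5, w6⟩ := (c.mem_iff j hj.1 hj.2 v).1 hw
  have hv0 := List.length_pos_of_ne_nil w1
  rw [cycle_head] at hk
  rw [cycle_head, cycle_tail] at hkl
  rw [cycle_tail] at hl
  simp only [List.length_append, length_wpow, Nat.cast_add, Nat.cast_mul, one_mul] at hkl
  obtain ⟨i1, i2, i3, i4, i5⟩ := hk.runs h.not_mem_z (not_mem_of_mem_wpow h.not_mem_o)
  obtain ⟨j1, j2, j3⟩ := hl.run w3
  have e1 : ((o.length : ℤ) + 1) * z.length ≤ c.padU i * z.length := by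
    exact_mod_cast Nat.mul_le_mul_right _ (c.le_padU i hi.1 hi.2)
  have e2 : ((o.length : ℤ) + 1) * z.length ≤ c.pad j v * z.length := by
    exact_mod_cast Nat.mul_le_mul_right _ (c.le_pad j hj.1 hj.2 v hw)
  have e3 : (z.length : ℤ) ≤ o.length * z.length := by
    exact_mod_cast Nat.le_mul_of_pos_left _ hq
  have e4 : (o.length : ℤ) ≤ i * o.length := by exact_mod_cast Nat.le_mul_of_pos_left _ hi.1
  simp only [length_wpow, Nat.cast_mul, Nat.cast_one, one_mul, add_mul] at i1 i2 i3 i4 i5 j1 j2 j3 e1 e2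
  have := run_eq_fst_run (p := z.length) (by omega) i1 i2 i3 i4 i5 j1 j2 j3 (by linarith)
    (by omega) (by linarith) (by omega) rfl (by linarith) (by omega) rfl
    (hkl.imp (fun hh => ⟨hh.1, by linarith [hh.2]⟩) (fun hh => ⟨hh.1, by linarith [hh.2]⟩))
    (by linarith)
  obtain ⟨h1, h2⟩ := this
  have hlen : v.length = o.length := by omega
  have h3 : v = o := by
    simp only [occursAt_append, List.length_append, length_wpow, Nat.cast_mul] at hk hl
    have h4 := hl.1.2
    rw [← h1] at h4
    exact h4.eq_of_length_eq hk.1.1.1.2 hlen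
  subst h3
  exact (w6 (class_eq_numClasses hp hj w5 h.length_modEq)).1 rfl

/-- The marker-free runs coincide, so `u = v`, and the length of this word determines its class. -/
theorem cycle_overlap_tail_tail (hi : i ∈ Set.Icc 1 (numClasses z o))
    (hj : j ∈ Set.Icc 1 (numClasses z o)) (hu : u ∈ c.words i) (hv : v ∈ c.words j)
    (hk : OccursAt x (wpow z (c.pad i u) ++ u ++ z) k)
    (hl : OccursAt x (wpow z (c.pad j v) ++ v ++ z) l) (hkl : k ≤ l)
    (hlk : l + z.length < k + (wpow z (c.pad i u) ++ u ++ z).length) :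
    k = l ∧ i = j ∧ u = v := by
  have hp := h.length_pos
  have hq := h.length_pos'
  obtain ⟨u1, u2, u3, u4, u5, u6⟩ := (c.mem_iff i hi.1 hi.2 u).1 hu
  obtain ⟨w1, w2, w3, w4, w5, w6⟩ := (c.mem_iff j hj.1 hj.2 v).1 hv
  have hu0 := List.length_pos_of_ne_nil u1
  have hv0 := List.length_pos_of_ne_nil w1
  rw [cycle_tail] at hk hl hlk
  simp only [List.length_append, length_wpow, Nat.cast_add, Nat.cast_mul, one_mul] at hlk
  obtain ⟨i1, i2, i3⟩ := hk.run u3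
  obtain ⟨j1, j2, j3⟩ := hl.run w3
  have e1 : (z.length : ℤ) ≤ c.pad i u * z.length := by
    exact_mod_cast Nat.le_mul_of_pos_left _ (by have := c.le_pad i hi.1 hi.2 u hu; omega)
  have e2 : (z.length : ℤ) ≤ c.pad j v * z.length := by
    exact_mod_cast Nat.le_mul_of_pos_left _ (by have := c.le_pad j hj.1 hj.2 v hv; omega)
  simp only [Nat.cast_one, one_mul] at i1 i2 i3 j1 j2 j3
  obtain ⟨h1, h2⟩ := run_eq_run (p := z.length) (by omega) i1 i2 i3 j1 j2 j3 (by linarith)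
    (by omega) le_rfl (by linarith) (by omega) le_rfl hkl (by linarith) (Or.inl rfl)
  have h3 : u = v := by
    simp only [occursAt_append, List.length_append, length_wpow, Nat.cast_mul] at hk hl
    have h4 := hl.1.2
    rw [← h1] at h4
    exact hk.1.2.eq_of_length_eq h4 (by omega)
  subst h3
  obtain rfl : i = j := class_unique hp hi hj u5 w5
  exact ⟨by linarith, rfl, rfl⟩

theorem cycle_overlap (hi : i ∈ Set.Icc 1 (numClasses z o))
    (hj : j ∈ Set.Icc 1 (numClasses z o)) (hu : u ∈ c.cycle i) (hv : v ∈ c.cycle j)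
    (hk : OccursAt x u k) (hl : OccursAt x v l) (hkl : k ≤ l)
    (hlk : l + z.length < k + u.length) : k = l ∧ i = j ∧ u = v := by
  rcases List.mem_cons.1 hu with rfl | hu' <;> rcases List.mem_cons.1 hv with rfl | hv'
  · obtain ⟨h1, rfl⟩ := h.cycle_overlap_head_head c hi hj hk hl hkl hlk
    exact ⟨h1, rfl, rfl⟩
  · obtain ⟨w, hw, rfl⟩ := List.mem_map.1 hv'
    exact (h.cycle_no_overlap_head_tail c hi hj hw hk hl (Or.inl ⟨hkl, hlk⟩)).elim
  · obtain ⟨w, hw, rfl⟩ := List.mem_map.1 hu'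
    exact (h.cycle_no_overlap_head_tail c hj hi hw hl hk (Or.inr ⟨hkl, hlk⟩)).elim
  · obtain ⟨w, hw, rfl⟩ := List.mem_map.1 hu'
    obtain ⟨w', hw', rfl⟩ := List.mem_map.1 hv'
    obtain ⟨h1, rfl, rfl⟩ := h.cycle_overlap_tail_tail c hi hj hw hw' hk hl hkl hlk
    exact ⟨h1, rfl, rfl⟩

omit h in
theorem cycle_length (hi : i ∈ Set.Icc 1 (numClasses z o)) (hu : u ∈ c.cycle i) :
    u.length = (wpow z (c.padU i) ++ wordU z o i ++ z).length := by
  rcases List.mem_cons.1 hu with rfl | hu'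
  · rfl
  · obtain ⟨w, hw, rfl⟩ := List.mem_map.1 hu'
    have := c.length_eq i hi.1 hi.2 w hw
    simp only [List.length_append] at this ⊢
    omega

theorem cycle_nodup (hi : i ∈ Set.Icc 1 (numClasses z o)) : (c.cycle i).Nodup := by
  have hp := h.length_pos
  have hq := h.length_pos'
  refine List.nodup_cons.2 ⟨fun hm => ?_, (List.nodup_map_iff_inj_on (c.nodup i hi.1 hi.2)).2
    fun u hu v hv huv => ?_⟩
  · obtain ⟨w, hw, he⟩ := List.mem_map.1 hm
    obtain ⟨x, hx⟩ := exists_config_occursAt (w := wpow z (c.padU i) ++ wordU z o i ++ z)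
      (by simp; omega)
    exact h.cycle_no_overlap_head_tail c hi hi hw hx (he ▸ hx)
      (Or.inl ⟨le_rfl, by simp only [List.length_append, wordU]; omega⟩)
  · obtain ⟨-, hu0, -⟩ := (c.mem_iff i hi.1 hi.2 u).1 hu
    have hu1 := List.length_pos_of_ne_nil ((c.mem_iff i hi.1 hi.2 u).1 hu).1
    have huv : wpow z (c.pad i u) ++ u ++ z = wpow z (c.pad i v) ++ v ++ z := huv
    obtain ⟨x, hx⟩ := exists_config_occursAt (w := wpow z (c.pad i u) ++ u ++ z)
      (by simp; omega)
    exact (h.cycle_overlap_tail_tail c hi hi hu hv hx (huv ▸ hx) le_rfl (by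
      simp only [List.length_append]; omega)).2.2

theorem cycle_mem (hi : i ∈ Set.Icc 1 (numClasses z o)) (hu : u ∈ c.cycle i) :
    u ∈ X.language ∧ (∃ m, u = z ++ m ++ z) ∧ ∃ a ∈ u, a ∉ z := by
  rcases List.mem_cons.1 hu with rfl | hu'
  · have hpad : 0 < c.padU i := by have := c.le_padU i hi.1 hi.2; omega
    rw [cycle_head]
    refine ⟨h.mem_language_runs h.isReturn_self (h.isReturn_wpow i) hpad h.length_pos' one_pos,
      ?_, ?_⟩
    · obtain ⟨m, hm⟩ := exists_bordered z (o ++ wpow z o.length ++ wpow o i) hpad one_pos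
      exact ⟨m, by simpa using hm⟩
    · obtain ⟨a, ha⟩ := List.exists_mem_of_length_pos h.length_pos'
      exact ⟨a, by simp [ha], h.not_mem_z a ha⟩
  · obtain ⟨w, hw, rfl⟩ := List.mem_map.1 hu'
    obtain ⟨w1, w2, w3, w4, w5, w6⟩ := (c.mem_iff i hi.1 hi.2 w).1 hw
    have hpad : 0 < c.pad i w := by have := c.le_pad i hi.1 hi.2 w hw; omega
    rw [cycle_tail]
    refine ⟨h.mem_language_run w4 hpad one_pos, exists_bordered z w hpad one_pos, ?_⟩
    obtain ⟨a, ha⟩ := List.exists_mem_of_length_pos (List.length_pos_of_ne_nil w1)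
    exact ⟨a, by simp [ha], w3 a ha⟩

theorem isBoundedRule_P4 : ∃ N, IsBoundedRule X z N
    (⋃ j ∈ Set.Icc 1 (numClasses z o), cyclicRule (c.cycle j)) := by
  refine ⟨(Finset.Icc 1 (numClasses z o)).sup
    fun j => (wpow z (c.padU j) ++ wordU z o j ++ z).length,
    isMarkerRule_iUnion h.length_pos (fun i hi => h.cycle_nodup c hi)
      (fun i hi u hu v hv => (cycle_length c hi hu).trans (cycle_length c hi hv).symm)
      (fun i hi u hu => (h.cycle_mem c hi hu).2.1)
      (fun x k l i hi j hj u hu v hv => h.cycle_overlap c hi hj hu hv), ?_, ?_, ?_⟩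
  all_goals
    intro r hr
    simp only [Set.mem_iUnion] at hr
    obtain ⟨i, hi, hr⟩ := hr
    have hr := fst_mem_of_mem_cyclicRule hr
  · exact (h.cycle_mem c hi hr).1
  · rw [cycle_length c hi hr]
    exact Finset.le_sup (f := fun j => (wpow z (c.padU j) ++ wordU z o j ++ z).length)
      (Finset.mem_Icc.2 hi)
  · exact (h.cycle_mem c hi hr).2.2

end Subshift.IsMarkerPair

/-! ### Framed words and their moves -/

section Barrier

variable {A : Type*}

/-- A word that is framed by two runs of different lengths. -/
def framedWord (z o : List A) (a : ℕ) (g : List A) : List A :=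
  z ++ wpow o a ++ g ++ wpow o (a + 1) ++ z

/-- The number of repetitions of `o` that frame the word `m`. -/
def frameSize (z m : List A) : ℕ := m.length + z.length + 1

/-- The rule that moves the word `m` in its frame by one marker. -/
def framedRule (z o m : List A) : Set (List A × List A) :=
  cyclicRule [framedWord z o (frameSize z m) (z ++ m ++ (z ++ z)),
    framedWord z o (frameSize z m) ((z ++ z) ++ m ++ z)]

variable {z o m : List A} {x : ℤ → A} {k l : ℤ} {a : ℕ}

theorem length_framedWord (g : List A) : (framedWord z o a g).length =
    z.length + a * o.length + g.length + (a + 1) * o.length + z.length := by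
  simp [framedWord]; ring

/-- The left frame `o^a` of the second word is a run enclosed by markers. It is too long for the
content `t`, and it cannot be the right frame `o^(a+1)`, whose length differs; so it is the left
frame of the first word. -/
theorem framedWord_overlap (hz : 0 < z.length) (ho : 0 < o.length) (hzo : ∀ b ∈ o, b ∉ z)
    {t t' : List A} (ht : t.length < a * o.length) (htt : t.length = t'.length)
    (hk : OccursAt x (framedWord z o a (z ++ t ++ z)) k)
    (hl : OccursAt x (framedWord z o a (z ++ t' ++ z)) l) (hkl : k ≤ l)
    (hlk : l + z.length < k + (framedWord z o a (z ++ t ++ z)).length) : k = l := by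
  have hoz : ∀ {n : ℕ}, ∀ b ∈ wpow o n, b ∉ z := fun b hb => hzo b (mem_of_mem_wpow hb)
  rw [length_framedWord] at hlk
  simp only [framedWord, occursAt_append, List.length_append, length_wpow] at hk hl hlk
  obtain ⟨⟨⟨⟨k1, k2⟩, ⟨k3, -⟩, k4⟩, k5⟩, k6⟩ := hk
  obtain ⟨⟨⟨⟨l1, l2⟩, ⟨l3, -⟩, l4⟩, l5⟩, l6⟩ := hl
  have i1 := k1.markerOn (fun _ hb => hb) rfl
  have i3 := k3.markerOn (fun _ hb => hb) rfl
  have i4 := k4.markerOn (fun _ hb => hb) rfl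
  have i5 := k5.markerFreeOn hoz rfl
  have i6 := k6.markerOn (fun _ hb => hb) rfl
  have j1 := l1.markerOn (fun _ hb => hb) rfl
  have j2 := l2.markerFreeOn hoz rfl
  have j3 := l3.markerOn (fun _ hb => hb) rfl
  have i2 := k2.markerFreeOn hoz rfl
  simp only [length_wpow] at i2 i5 j2
  push_cast [add_mul] at *
  have d1 := i1.le_or_le j2 (by omega) (by omega)
  have d3 := i3.le_or_le j2 (by omega) (by omega)
  have d4 := i4.le_or_le j2 (by omega) (by omega)
  have d6 := i6.le_or_le j2 (by omega) (by omega)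
  have e1 := j1.le_or_le i2 (by omega) (by omega)
  have e2 := j1.le_or_le i5 (by omega) (by omega)
  have e4 := j3.le_or_le i5 (by omega) (by omega)
  omega

theorem framedWord_eq_left (z o m : List A) (a : ℕ) : framedWord z o a (z ++ m ++ (z ++ z)) =
    framedWord z o a (z ++ (m ++ z) ++ z) := by simp

theorem framedWord_eq_right (z o m : List A) (a : ℕ) : framedWord z o a ((z ++ z) ++ m ++ z) =
    framedWord z o a (z ++ (z ++ m) ++ z) := by simp

theorem length_lt_frame (ho : 0 < o.length) : (m ++ z).length < frameSize z m * o.length := by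
  have := Nat.le_mul_of_pos_right (frameSize z m) ho
  simp only [List.length_append, frameSize] at *
  omega

/-- Cancelling the common ends of equal words would leave `m z = z m`, forcing all letters of `m`
into `z`. -/
theorem framedWord_ne (hz : 0 < z.length) (hm : ∃ b ∈ m, b ∉ z) :
    framedWord z o a (z ++ m ++ (z ++ z)) ≠ framedWord z o a ((z ++ z) ++ m ++ z) := by
  intro he
  obtain ⟨b, hb, hbz⟩ := hm
  refine hbz (mem_of_append_comm hz ?_ b hb)
  refine List.append_cancel_right (bs := z ++ (wpow o (a + 1) ++ z)) ?_
  simpa [framedWord] using he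

theorem isMarkerRule_framedRule (hz : 0 < z.length) (ho : 0 < o.length) (hzo : ∀ b ∈ o, b ∉ z)
    (hm : ∃ b ∈ m, b ∉ z) : IsMarkerRule z (framedRule z o m) := by
  have hlen : (framedWord z o (frameSize z m) (z ++ m ++ (z ++ z))).length =
      (framedWord z o (frameSize z m) ((z ++ z) ++ m ++ z)).length := by
    simp only [length_framedWord, List.length_append]
    ring
  refine isMarkerRule_pair hz (framedWord_ne hz hm) hlen ?_ ?_ ?_
  · exact ⟨wpow o (frameSize z m) ++ (z ++ m ++ (z ++ z)) ++ wpow o (frameSize z m + 1),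
      by simp [framedWord]⟩
  · exact ⟨wpow o (frameSize z m) ++ (z ++ z ++ m ++ z) ++ wpow o (frameSize z m + 1),
      by simp [framedWord]⟩
  · intro x k l w hw w' hw' hk hl hkl hlk
    have hw1 : ∃ t, t.length = (m ++ z).length ∧
        w = framedWord z o (frameSize z m) (z ++ t ++ z) := by
      rcases List.mem_pair.1 hw with rfl | rfl
      · exact ⟨m ++ z, rfl, framedWord_eq_left ..⟩
      · exact ⟨z ++ m, by simp [add_comm], framedWord_eq_right ..⟩
    have hw1' : ∃ t, t.length = (m ++ z).length ∧
        w' = framedWord z o (frameSize z m) (z ++ t ++ z) := by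
      rcases List.mem_pair.1 hw' with rfl | rfl
      · exact ⟨m ++ z, rfl, framedWord_eq_left ..⟩
      · exact ⟨z ++ m, by simp [add_comm], framedWord_eq_right ..⟩
    obtain ⟨t, ht, rfl⟩ := hw1
    obtain ⟨t', ht', rfl⟩ := hw1'
    have hfr := length_lt_frame (z := z) (m := m) ho
    have := framedWord_overlap hz ho hzo (ht ▸ hfr) (ht.trans ht'.symm) hk hl hkl (by
      rw [framedWord_eq_left] at hlk
      simp only [length_framedWord, List.length_append] at *
      omega)
    subst this
    refine ⟨rfl, hk.eq_of_length_eq hl ?_⟩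
    simp only [length_framedWord, List.length_append] at *
    omega

/-- Short words do not interact with words whose marker-free runs are long. -/
theorem not_overlap_of_long_runs {w u v t : List A} {b c : ℕ}
    (hz : 0 < z.length) (hw : ∃ n, w = z ++ n ++ z) (hw' : ∃ a ∈ w, a ∉ z)
    (hu : ∀ b ∈ u, b ∉ z) (hv : ∀ b ∈ v, b ∉ z) (ht : ∀ b ∈ t, b ∉ z)
    (hul : w.length ≤ u.length) (hvl : w.length ≤ v.length) (htl : w.length ≤ t.length)
    (hk : OccursAt x w k)
    (hl : OccursAt x (z ++ u ++ wpow z b ++ v ++ wpow z c ++ t ++ z) l) :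
    k + w.length ≤ l + z.length ∨
      l + (z ++ u ++ wpow z b ++ v ++ wpow z c ++ t ++ z).length ≤ k + z.length := by
  obtain ⟨y, hy, hyz⟩ := hw'
  obtain ⟨i, hi, rfl⟩ := List.mem_iff_getElem.1 hy
  rw [← hk i hi] at hyz
  obtain ⟨n, hn⟩ := hw
  have hkz : OccursAt x z k ∧ OccursAt x z (k + w.length - z.length) := by
    rw [hn, occursAt_append, occursAt_append] at hk
    refine ⟨hk.1.1, ?_⟩
    convert hk.2 using 1
    rw [hn]
    simp
    ring
  have hwl : z.length ≤ w.length := by rw [hn]; simp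
  have m1 := hkz.1.markerOn (fun _ hb => hb) rfl
  have m2 := hkz.2.markerOn (fun _ hb => hb) rfl
  simp only [occursAt_append, List.length_append, length_wpow] at hl ⊢
  obtain ⟨⟨⟨⟨⟨⟨l1, l2⟩, l3⟩, l4⟩, l5⟩, l6⟩, l7⟩ := hl
  have n2 := l2.markerFreeOn hu rfl
  have n4 := l4.markerFreeOn hv rfl
  have n6 := l6.markerFreeOn ht rfl
  have z1 := l1.markerOn (fun _ hb => hb) rfl
  have z3 := l3.markerOn (fun _ => mem_of_mem_wpow) rfl
  have z5 := l5.markerOn (fun _ => mem_of_mem_wpow) rfl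
  have z7 := l7.markerOn (fun _ hb => hb) rfl
  -- The non-marker letter at `k + i` avoids all marker stretches. Nor can it lie in a long run,
  -- since the markers at both ends of `w` would have to fall on either side of that run. So it lies
  -- outside the long word, and `w` reaches into it by at most a marker for the same reason.
  have key : ∀ {α β}, MarkerOn z x α β → k + i < α ∨ β ≤ k + i := fun {α β} hm => by
    by_contra hcon
    exact hyz (hm _ (by omega) (by omega))
  simp only [length_wpow] at z3 z5
  push_cast at *
  have f2 := m1.le_or_le n2 (by omega) (by omega)
  have f4 := m1.le_or_le n4 (by omega) (by omega)
  have f6 := m1.le_or_le n6 (by omega) (by omega)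
  have g2 := m2.le_or_le n2 (by omega) (by omega)
  have g4 := m2.le_or_le n4 (by omega) (by omega)
  have g6 := m2.le_or_le n6 (by omega) (by omega)
  have h1 := key z1
  have h3 := key z3
  have h5 := key z5
  have h7 := key z7
  omega

/-- For the moved word `o^M` both framed words have three marker-free runs, each of length at least
`M ≥ N`. -/
theorem nonInteracting_framedRule [TopologicalSpace A] {X : Subshift A} {N M : ℕ}
    {R : Set (List A × List A)} (hR : IsBoundedRule X z N R) (ho : 0 < o.length)
    (hzo : ∀ b ∈ o, b ∉ z) (hM : N ≤ M) : NonInteracting z R (framedRule z o (wpow o M)) := by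
  intro x k l r hr s hs hk hl
  have hoz : ∀ {n : ℕ}, ∀ b ∈ wpow o n, b ∉ z := fun b hb => hzo b (mem_of_mem_wpow hb)
  have h1 := (hR.length_le r hr).trans hM
  have h2 := Nat.le_mul_of_pos_right M ho
  have h3 := Nat.le_mul_of_pos_right (frameSize z (wpow o M)) ho
  have h4 : M ≤ frameSize z (wpow o M) := by simp only [frameSize, length_wpow]; omega
  have hform : ∃ b c, s.1 = z ++ wpow o (frameSize z (wpow o M)) ++ wpow z b ++ wpow o M ++
      wpow z c ++ wpow o (frameSize z (wpow o M) + 1) ++ z := by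
    rcases List.mem_pair.1 (fst_mem_of_mem_cyclicRule hs) with h | h <;> rw [h]
    · exact ⟨1, 2, by simp [framedWord, wpow_succ z, wpow_zero]⟩
    · exact ⟨2, 1, by simp [framedWord, wpow_succ z, wpow_zero]⟩
  obtain ⟨b, c, hs1⟩ := hform
  rw [hs1] at hl ⊢
  exact not_overlap_of_long_runs hR.marker_pos (hR.bordered r hr) (hR.exists_not_mem r hr)
    hoz hoz hoz (by rw [length_wpow]; omega) (by rw [length_wpow]; omega)
    (by rw [length_wpow, add_mul]; omega) hk hl

end Barrier

/-! ### Moves as automorphisms, and points that witness them -/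

namespace Subshift.IsMarkerPair

variable {A : Type*} [TopologicalSpace A] {X : Subshift A} {z o m : List A}
variable (h : X.IsMarkerPair z o)
include h

theorem framedWord_mem (hm : X.IsReturn z m) (a : ℕ) :
    framedWord z o a (z ++ m ++ (z ++ z)) ∈ X.language ∧
    framedWord z o a ((z ++ z) ++ m ++ z) ∈ X.language := by
  have h1 := (((h.isReturn_wpow a).append h.z_synchronizing hm).append h.z_synchronizing
    h.isReturn_nil).append h.z_synchronizing (h.isReturn_wpow (a + 1))
  have h2 := (((h.isReturn_wpow a).append h.z_synchronizing h.isReturn_nil).append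
    h.z_synchronizing hm).append h.z_synchronizing (h.isReturn_wpow (a + 1))
  exact ⟨by simpa [framedWord, IsReturn] using h1, by simpa [framedWord, IsReturn] using h2⟩

theorem isBoundedRule_framedRule (hm : X.IsReturn z m) (hm' : ∃ b ∈ m, b ∉ z) :
    IsBoundedRule X z (framedWord z o (frameSize z m) (z ++ m ++ (z ++ z))).length
      (framedRule z o m) := by
  have hl := h.framedWord_mem hm (frameSize z m)
  refine ⟨isMarkerRule_framedRule h.length_pos h.length_pos' h.not_mem_z hm', ?_, ?_, ?_⟩ <;>
    intro r hr <;>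
    rcases List.mem_pair.1 (fst_mem_of_mem_cyclicRule hr) with hr | hr <;> rw [hr]
  · exact hl.1
  · exact hl.2
  · simp only [length_framedWord, List.length_append]
    omega
  all_goals
    obtain ⟨b, hb, hbz⟩ := hm'
    exact ⟨b, by simp [framedWord, hb], hbz⟩

theorem exists_framedAut [DiscreteTopology A] (hm : X.IsReturn z m) (hm' : ∃ b ∈ m, b ∉ z) :
    ∃ g : X.Aut, X.Restricts (replaceAll (framedRule z o m)) g :=
  have hR := h.isBoundedRule_framedRule hm hm'
  hR.exists_aut h.z_synchronizing hR.mem_language hR.length_le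

/-- A word between markers, continued by markers. -/
theorem exists_finite_point {w : List A} (hw : z ++ w ++ z ∈ X.language) :
    ∃ x ∈ X.carrier, OccursAt x (z ++ w ++ z) 0 ∧ (∀ i < 0, x i ∈ z) ∧
      ∀ i : ℤ, (z ++ w ++ z).length ≤ i → x i ∈ z := by
  obtain ⟨y, hy, hyz⟩ := h.z_periodic
  obtain ⟨t, ht, hto⟩ := exists_occursAt hw 0
  have hp := h.length_pos
  have hyz' : ∀ i, y i ∈ z := fun i => by
    have h1 := Int.emod_nonneg i (b := z.length) (by omega)
    have h2 := Int.emod_lt_of_pos i (b := z.length) (by omega)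
    have h3 := Int.emod_add_ediv_mul i z.length
    exact (hyz (i / z.length)).mem (by omega) (by omega)
  have hy0 : OccursAt y z 0 := by simpa using hyz 0
  have ht' := occursAt_append.1 hto
  have ht'' := occursAt_append.1 ht'.1
  have hs := glue_mem h.z_synchronizing hy ht hy0 ht''.1
  have hk : (0 : ℤ) + ((z ++ w).length : ℤ) = (z ++ w).length := zero_add _
  rw [hk] at ht'
  have hs2 := glue_mem h.z_synchronizing hs (comp_add_mem hy (-(z ++ w).length))
    (k := (z ++ w).length) (ht'.2.congr fun i hi _ => by rw [if_neg (by omega)])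
    ((occursAt_comp_add _).2 (by simpa using hy0))
  have hl := List.length_append (as := z ++ w) (bs := z)
  refine ⟨_, hs2, ?_, fun i hi => ?_, fun i hi => ?_⟩
  · refine occursAt_append.2 ⟨ht'.1.congr fun i hi hi' => ?_, ?_⟩
    · rw [if_pos (by omega), if_neg (by omega)]
    · rw [hk]
      refine OccursAt.congr ((occursAt_comp_add (-((z ++ w).length : ℤ))).2
        (by simpa using hy0) : OccursAt (fun i => y (i + -((z ++ w).length : ℤ))) z _)
        fun i hi hi' => ?_
      rw [if_neg (by omega)]
  · rw [if_pos (by omega), if_pos hi]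
    exact hyz' i
  · rw [if_neg (by omega)]
    exact hyz' _

/-- A point with a single occurrence of a word of the rule. -/
theorem exists_framed_point (hm : X.IsReturn z m) (hm' : ∃ b ∈ m, b ∉ z) :
    ∃ x ∈ X.carrier, OccursAt x (framedWord z o (frameSize z m) (z ++ m ++ (z ++ z))) 0 ∧
      (∀ i < 0, x i ∈ z) ∧ ∀ r ∈ framedRule z o m, ∀ l, OccursAt x r.1 l → l = 0 := by
  have hR := isMarkerRule_framedRule h.length_pos h.length_pos' h.not_mem_z hm'
  have hr0 : (framedWord z o (frameSize z m) (z ++ m ++ (z ++ z)),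
      framedWord z o (frameSize z m) ((z ++ z) ++ m ++ z)) ∈ framedRule z o m :=
    mem_cyclicRule_pair.2 (Or.inl rfl)
  obtain ⟨w, hw⟩ := hR.bordered _ hr0
  have hL := (h.framedWord_mem hm (frameSize z m)).1
  simp only at hw
  obtain ⟨x, hx, hx0, hx1, hx2⟩ := h.exists_finite_point (hw ▸ hL)
  rw [← hw] at hx0 hx2
  refine ⟨x, hx, hx0, hx1, fun r hr l hl => ?_⟩
  have hp := h.length_pos
  have hq := h.length_pos'
  have hrl : r.1.length = (framedWord z o (frameSize z m) (z ++ m ++ (z ++ z))).length := by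
    rcases List.mem_pair.1 (fst_mem_of_mem_cyclicRule hr) with h1 | h1 <;> rw [h1]
    simp only [length_framedWord, List.length_append]
    ring
  -- The left frame of any occurrence starts at `l + z.length`, and outside the word at 0 there are
  -- only marker letters. Hence this position is inside that word, and the two occurrences share
  -- more than a marker.
  have hfree : x (l + z.length) ∉ z := by
    have h1 : OccursAt x (wpow o (frameSize z m)) (l + z.length) := by
      rcases List.mem_pair.1 (fst_mem_of_mem_cyclicRule hr) with h1 | h1 <;> rw [h1] at hl <;>
        simp only [framedWord, occursAt_append] at hl
      exacts [hl.1.1.1.2, hl.1.1.1.2]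
    refine h1.markerFreeOn (not_mem_of_mem_wpow h.not_mem_o) rfl _ le_rfl ?_
    have : 0 < (wpow o (frameSize z m)).length := by simp [frameSize, hq]
    omega
  have hlong : 2 * z.length < (framedWord z o (frameSize z m) (z ++ m ++ (z ++ z))).length := by
    rw [length_framedWord]
    simp only [List.length_append]
    omega
  have hlow : 0 ≤ l + z.length := by
    by_contra hc
    exact hfree (hx1 _ (by omega))
  have hhigh : l + z.length < (framedWord z o (frameSize z m) (z ++ m ++ (z ++ z))).length := by
    by_contra hc
    exact hfree (hx2 _ (by omega))
  rcases le_total 0 l with h0 | h0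
  · exact (hR.overlap x 0 l _ hr0 r hr hx0 hl h0 (by simp only; omega)).1.symm
  · exact (hR.overlap x l 0 r hr _ hr0 hl hx0 h0 (by omega)).1

end Subshift.IsMarkerPair

namespace Subshift

variable {A : Type*} [TopologicalSpace A] {X : Subshift A}

theorem σ_zpow_apply (n : ℤ) (x : X.carrier) (i : ℤ) :
    (((X.σ ^ n : X.Aut) : X.carrier ≃ₜ X.carrier) x : ℤ → A) i = (x : ℤ → A) (i + n) := by
  induction n generalizing x with
  | zero => simp
  | succ n ih =>
    rw [zpow_add_one]
    refine (ih (X.shiftHomeo x)).trans ?_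
    show (x : ℤ → A) (i + n + 1) = _
    rw [add_assoc]
  | pred n ih =>
    rw [zpow_sub_one]
    refine (ih (X.shiftHomeo.symm x)).trans ?_
    show (x : ℤ → A) (i + -n - 1) = _
    ring_nf

theorem commute_σ (g : X.Aut) : Commute X.σ g :=
  Subtype.ext (Subgroup.mem_centralizer_singleton_iff.1 g.2).symm

theorem Restricts.ext {f : (ℤ → A) → (ℤ → A)} {g g' : X.Aut} (h : X.Restricts f g)
    (h' : X.Restricts f g') : g = g' :=
  Subtype.ext (Homeomorph.ext fun x => Subtype.ext ((h x).trans (h' x).symm))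

theorem Restricts.mul {f f' : (ℤ → A) → (ℤ → A)} {g g' : X.Aut} (h : X.Restricts f g)
    (h' : X.Restricts f' g') : X.Restricts (f ∘ f') (g * g') := fun x => by
  show ((g : X.carrier ≃ₜ X.carrier) ((g' : X.carrier ≃ₜ X.carrier) x) : ℤ → A) = f (f' x)
  rw [h, h']

theorem Restricts.commute {f f' : (ℤ → A) → (ℤ → A)} {g g' : X.Aut} (h : X.Restricts f g)
    (h' : X.Restricts f' g') (hc : ∀ x, f (f' x) = f' (f x)) : Commute g g' :=
  (h.mul h').ext (by convert h'.mul h using 1; exact funext hc)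

end Subshift

namespace Subshift.IsMarkerPair

variable {A : Type*} [TopologicalSpace A] {X : Subshift A} {z o m : List A}
variable (h : X.IsMarkerPair z o)
include h

/-- On the point with a single framed word the first non-marker letter is at `z.length` before and
after the move, so a shift could only be trivial; but the move changes the point. -/
theorem not_mem_zpowers (hm : X.IsReturn z m) (hm' : ∃ b ∈ m, b ∉ z) {g : X.Aut}
    (hg : X.Restricts (replaceAll (framedRule z o m)) g) : g ∉ Subgroup.zpowers X.σ := by
  rintro ⟨d, rfl⟩
  have hR := isMarkerRule_framedRule h.length_pos h.length_pos' h.not_mem_z hm'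
  obtain ⟨x, hx, hx0, hx1, hx2⟩ := h.exists_framed_point hm hm'
  have hp := h.length_pos
  have hq := h.length_pos'
  have hy0 := hR.occursAt_replaceAll (mem_cyclicRule_pair.2 (Or.inl rfl)) hx0
  have hshift : ∀ i, replaceAll (framedRule z o m) x i = x (i + d) := fun i => by
    rw [← hg ⟨x, hx⟩]
    exact σ_zpow_apply d _ i
  have hy1 : ∀ i < 0, replaceAll (framedRule z o m) x i ∈ z := fun i hi => by
    rw [hR.replaceAll_apply_eq_self fun r hr k hk hki => ?_]
    · exact hx1 i hi
    · rw [hx2 r hr k hk] at hki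
      omega
  have hfirst : ∀ {y : ℤ → A} {g : List A}, OccursAt y (framedWord z o (frameSize z m) g) 0 →
      (∀ i < 0, y i ∈ z) → y z.length ∉ z ∧ ∀ i < (z.length : ℤ), y i ∈ z := by
    intro y g hy hneg
    simp only [framedWord, occursAt_append, zero_add] at hy
    refine ⟨?_, fun i hi => ?_⟩
    · refine hy.1.1.1.2.markerFreeOn (not_mem_of_mem_wpow h.not_mem_o) rfl _ le_rfl ?_
      have : 0 < (wpow o (frameSize z m)).length := by simp [frameSize, hq]
      omega
    · rcases lt_or_ge i 0 with h0 | h0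
      · exact hneg i h0
      · exact hy.1.1.1.1.mem h0 (by omega)
  obtain ⟨a1, a2⟩ := hfirst hx0 hx1
  obtain ⟨b1, b2⟩ := hfirst hy0 hy1
  have hd1 : 0 ≤ d := by
    by_contra hd
    rw [hshift] at b1
    exact b1 (a2 _ (by omega))
  have hd2 : d ≤ 0 := by
    by_contra hd
    have := b2 (z.length - d) (by omega)
    rw [hshift, sub_add_cancel] at this
    exact a1 this
  obtain rfl : d = 0 := le_antisymm hd2 hd1
  have hxy : replaceAll (framedRule z o m) x = x := funext fun i => by rw [hshift, add_zero]
  rw [hxy] at hy0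
  refine framedWord_ne hp hm' (hx0.eq_of_length_eq hy0 ?_)
  simp only [length_framedWord, List.length_append]
  ring

theorem barrier_prop {M : ℕ} (hM : 0 < M) :
    X.IsReturn z (wpow o M) ∧ ∃ b ∈ wpow o M, b ∉ z := by
  refine ⟨h.isReturn_wpow M, ?_⟩
  obtain ⟨b, hb⟩ := List.exists_mem_of_length_pos (l := wpow o M) (by simp [hM, h.length_pos'])
  exact ⟨b, hb, not_mem_of_mem_wpow h.not_mem_o b hb⟩

theorem isMarkerRule_barrier {M : ℕ} (hM : 0 < M) :
    IsMarkerRule z (framedRule z o (wpow o M)) :=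
  isMarkerRule_framedRule h.length_pos h.length_pos' h.not_mem_z (h.barrier_prop hM).2

end Subshift.IsMarkerPair

/-! ### Commutation with the moves of long runs -/

/-- The maps that commute with all moves of sufficiently long runs. -/
def EventuallyCommutes {A : Type*} (z o : List A) (f : (ℤ → A) → (ℤ → A)) : Prop :=
  ∃ N, ∀ M ≥ N, ∀ x, f (replaceAll (framedRule z o (wpow o M)) x) =
    replaceAll (framedRule z o (wpow o M)) (f x)

/-- The automorphisms that commute with all moves of sufficiently long runs. -/
def Subshift.eventualCentralizer {A : Type*} [TopologicalSpace A] (X : Subshift A) (z o : List A) :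
     Subgroup X.Aut where
  carrier := {g | ∃ N, ∀ M ≥ N, ∀ b : X.Aut,
    X.Restricts (replaceAll (framedRule z o (wpow o M))) b → Commute g b}
  one_mem' := ⟨0, fun _ _ b _ => Commute.one_left b⟩
  mul_mem' := by
    rintro g g' ⟨N, hg⟩ ⟨N', hg'⟩
    exact ⟨max N N', fun M hM b hb => (hg M (le_trans (le_max_left _ _) hM) b hb).mul_left
      (hg' M (le_trans (le_max_right _ _) hM) b hb)⟩
  inv_mem' := by
    rintro g ⟨N, hg⟩
    exact ⟨N, fun M hM b hb => (hg M hM b hb).inv_left⟩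

theorem EventuallyCommutes.comp {A : Type*} {z o : List A} {f f' : (ℤ → A) → (ℤ → A)}
    (h : EventuallyCommutes z o f) (h' : EventuallyCommutes z o f') :
    EventuallyCommutes z o (f ∘ f') := by
  obtain ⟨N, h⟩ := h
  obtain ⟨N', h'⟩ := h'
  refine ⟨max N N', fun M hM x => ?_⟩
  simp only [Function.comp_apply]
  rw [h' M (le_trans (le_max_right _ _) hM), h M (le_trans (le_max_left _ _) hM)]

namespace Subshift.IsMarkerPair

variable {A : Type*} [TopologicalSpace A] {X : Subshift A} {z o m : List A}
variable (h : X.IsMarkerPair z o)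
include h

theorem eventuallyCommutes_replaceAll {N : ℕ} {R : Set (List A × List A)}
    (hR : IsBoundedRule X z N R) : EventuallyCommutes z o (replaceAll R) :=
  ⟨N + 1, fun _ hM x => (h.isMarkerRule_barrier (by omega)).replaceAll_comm hR.toIsMarkerRule
    (nonInteracting_framedRule hR h.length_pos' h.not_mem_z (by omega)).symm x⟩

theorem eventuallyCommutes_mapG {n : ℕ} (c : GliderChoice z o X n) :
    EventuallyCommutes z o (mapG c) := by
  obtain ⟨_, h1⟩ := h.isBoundedRule_P1
  obtain ⟨_, h2⟩ := h.isBoundedRule_P2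
  obtain ⟨_, h4⟩ := h.isBoundedRule_P4 c
  exact (h.eventuallyCommutes_replaceAll h4).comp
    ((h.eventuallyCommutes_replaceAll h2).comp (h.eventuallyCommutes_replaceAll h1))

theorem eventuallyCommutes_mapF : EventuallyCommutes z o (mapF z o) := by
  obtain ⟨_, h1⟩ := h.isBoundedRule_F1
  obtain ⟨_, h2⟩ := h.isBoundedRule_F2
  exact (h.eventuallyCommutes_replaceAll h2).comp (h.eventuallyCommutes_replaceAll h1)

variable [DiscreteTopology A]

theorem exists_restricts_mapG {n : ℕ} (c : GliderChoice z o X n) :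
    ∃ g : X.Aut, X.Restricts (mapG c) g := by
  obtain ⟨_, h1⟩ := h.isBoundedRule_P1
  obtain ⟨_, h2⟩ := h.isBoundedRule_P2
  obtain ⟨_, h4⟩ := h.isBoundedRule_P4 c
  obtain ⟨g1, hg1⟩ := h1.exists_aut h.z_synchronizing h1.mem_language h1.length_le
  obtain ⟨g2, hg2⟩ := h2.exists_aut h.z_synchronizing h2.mem_language h2.length_le
  obtain ⟨g4, hg4⟩ := h4.exists_aut h.z_synchronizing h4.mem_language h4.length_le
  exact ⟨_, hg4.mul (hg2.mul hg1)⟩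

theorem exists_restricts_mapF : ∃ g : X.Aut, X.Restricts (mapF z o) g := by
  obtain ⟨_, h1⟩ := h.isBoundedRule_F1
  obtain ⟨_, h2⟩ := h.isBoundedRule_F2
  obtain ⟨g1, hg1⟩ := h1.exists_aut h.z_synchronizing h1.mem_language h1.length_le
  obtain ⟨g2, hg2⟩ := h2.exists_aut h.z_synchronizing h2.mem_language h2.length_le
  exact ⟨_, hg2.mul hg1⟩

omit h [DiscreteTopology A] in
theorem mem_eventualCentralizer {f : (ℤ → A) → (ℤ → A)} (hf : EventuallyCommutes z o f)
    {g : X.Aut} (hg : X.Restricts f g) : g ∈ X.eventualCentralizer z o := by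
  obtain ⟨N, hN⟩ := hf
  exact ⟨N, fun M hM b hb => hg.commute hb (hN M hM)⟩

/-- Finiteness of `S` yields one bound for all its elements, and a single move beyond that bound
centralizes `S`. -/
theorem zpowers_lt_centralizer {S : Set X.Aut} (hS : S.Finite)
    (hSc : S ⊆ X.eventualCentralizer z o) : Subgroup.zpowers X.σ < Subgroup.centralizer S := by
  have hN : ∃ N, ∀ g ∈ S, ∀ M ≥ N, ∀ b : X.Aut,
      X.Restricts (replaceAll (framedRule z o (wpow o M))) b → Commute g b := by
    choose! n hn using fun g (hg : g ∈ S) => show ∃ N, _ from hSc hg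
    obtain ⟨N, hN⟩ := (hS.image n).bddAbove
    exact ⟨N, fun g hg M hM => hn g hg M (le_trans (hN ⟨g, hg, rfl⟩) hM)⟩
  obtain ⟨N, hN⟩ := hN
  -- `N + 1` instead of `N` keeps the moved run nonempty.
  obtain ⟨h1, h2⟩ := h.barrier_prop (M := N + 1) (by omega)
  obtain ⟨b, hb⟩ := h.exists_framedAut h1 h2
  refine lt_of_le_of_ne ?_ fun he => ?_
  · rw [Subgroup.zpowers_le, Subgroup.mem_centralizer_iff]
    exact fun g _ => (commute_σ g).symm
  · refine h.not_mem_zpowers h1 h2 hb (he ▸ Subgroup.mem_centralizer_iff.2 fun g hg => ?_)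
    exact hN g hg (N + 1) (by omega) b hb

end Subshift.IsMarkerPair

/-! ### Radius of an automorphism and consequences of transitivity -/

namespace Subshift

variable {A : Type*} [TopologicalSpace A] {X : Subshift A}

theorem aut_apply_add (f : X.Aut) (x : X.carrier) (n i : ℤ) :
    ((f : X.carrier ≃ₜ X.carrier) ⟨_, comp_add_mem x.2 n⟩ : ℤ → A) i =
      ((f : X.carrier ≃ₜ X.carrier) x : ℤ → A) (i + n) := by
  have h1 : (⟨_, comp_add_mem x.2 n⟩ : X.carrier) =
      ((X.σ ^ n : X.Aut) : X.carrier ≃ₜ X.carrier) x :=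
    Subtype.ext (funext fun i => (σ_zpow_apply n x i).symm)
  rw [h1, ← σ_zpow_apply]
  have h2 := congrArg (fun g : X.Aut => (g : X.carrier ≃ₜ X.carrier) x)
    ((commute_σ f).zpow_left n).eq
  exact (congrArg (fun y : X.carrier => (y : ℤ → A) i) h2).symm

/-- Automorphisms have a finite radius. -/
theorem exists_radius [Finite A] [DiscreteTopology A] (f : X.Aut) :
    ∃ r : ℕ, ∀ (x y : X.carrier) (i : ℤ),
      (∀ j, i - r ≤ j → j ≤ i + r → (x : ℤ → A) j = (y : ℤ → A) j) →
      ((f : X.carrier ≃ₜ X.carrier) x : ℤ → A) i = ((f : X.carrier ≃ₜ X.carrier) y : ℤ → A) i := by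
  have : CompactSpace X.carrier := isCompact_iff_compactSpace.1 X.isClosed.isCompact
  have h0 : ∃ r : ℕ, ∀ x y : X.carrier,
      (∀ j : ℤ, -r ≤ j → j ≤ r → (x : ℤ → A) j = (y : ℤ → A) j) →
      ((f : X.carrier ≃ₜ X.carrier) x : ℤ → A) 0 =
        ((f : X.carrier ≃ₜ X.carrier) y : ℤ → A) 0 := by
    by_contra! hcon
    -- Compactness: these are nested closed sets of pairs. If all were nonempty, a common element
    -- would be a pair of equal points with different images.
    let K : ℕ → Set (X.carrier × X.carrier) := fun n =>
      {q | (∀ j : ℤ, -n ≤ j → j ≤ n → (q.1 : ℤ → A) j = (q.2 : ℤ → A) j) ∧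
        ((f : X.carrier ≃ₜ X.carrier) q.1 : ℤ → A) 0 ≠
          ((f : X.carrier ≃ₜ X.carrier) q.2 : ℤ → A) 0}
    have hcoord : ∀ j : ℤ, Continuous fun x : X.carrier => (x : ℤ → A) j := fun j =>
      (continuous_apply j).comp continuous_subtype_val
    have hcl : ∀ n, IsClosed (K n) := fun n => by
      have hK : K n = (⋂ (j : ℤ) (_ : -n ≤ j) (_ : j ≤ n),
          {q | (q.1 : ℤ → A) j = (q.2 : ℤ → A) j}) ∩
          {q | ((f : X.carrier ≃ₜ X.carrier) q.1 : ℤ → A) 0 ≠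
            ((f : X.carrier ≃ₜ X.carrier) q.2 : ℤ → A) 0} := by
        ext q
        simp [K]
      rw [hK]
      refine IsClosed.inter ?_ ?_
      · exact isClosed_iInter fun j => isClosed_iInter fun _ => isClosed_iInter fun _ =>
          isClosed_eq ((hcoord j).comp continuous_fst) ((hcoord j).comp continuous_snd)
      · have hcont : Continuous fun q : X.carrier × X.carrier =>
            (((f : X.carrier ≃ₜ X.carrier) q.1 : ℤ → A) 0,
              ((f : X.carrier ≃ₜ X.carrier) q.2 : ℤ → A) 0) :=
          ((hcoord 0).comp ((f : X.carrier ≃ₜ X.carrier).continuous.comp continuous_fst)).prodMk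
            ((hcoord 0).comp ((f : X.carrier ≃ₜ X.carrier).continuous.comp continuous_snd))
        exact (isClosed_discrete {q : A × A | q.1 ≠ q.2}).preimage hcont
    obtain ⟨q, hq⟩ := IsCompact.nonempty_iInter_of_sequence_nonempty_isCompact_isClosed K
      (fun n q hq => ⟨fun j h1 h2 => hq.1 j (by push_cast; omega) (by push_cast; omega), hq.2⟩)
      (fun n => by
        obtain ⟨x, y, h1, h2⟩ := hcon n
        exact ⟨(x, y), h1, h2⟩)
      (hcl 0).isCompact hcl
    have hq := Set.mem_iInter.1 hq
    have heq : q.1 = q.2 := Subtype.ext (funext fun j =>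
      (hq j.natAbs).1 j (by omega) (by omega))
    exact (hq 0).2 (by rw [heq])
  obtain ⟨r, hr⟩ := h0
  refine ⟨r, fun x y i hxy => ?_⟩
  have h1 := aut_apply_add f x i 0
  have h2 := aut_apply_add f y i 0
  rw [zero_add] at h1 h2
  rw [← h1, ← h2]
  exact hr _ _ fun j hj hj' => hxy (j + i) (by omega) (by omega)

theorem IsTransitive.exists_infix (hX : X.IsTransitive) {u : List A} (hu : u ∈ X.language)
    (l : List (List A)) (hl : ∀ w ∈ l, w ∈ X.language) :
    ∃ m ∈ X.language, u <:+: m ∧ ∀ w ∈ l, w <:+: m := by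
  induction l with
  | nil => exact ⟨u, hu, List.infix_rfl, by simp⟩
  | cons v l ih =>
    obtain ⟨m, hm, h1, h2⟩ := ih fun w hw => hl w (List.mem_cons_of_mem _ hw)
    obtain ⟨t, -, ht⟩ := hX v (hl v List.mem_cons_self) m hm
    have h3 : m <:+: v ++ t ++ m := (List.suffix_append _ _).isInfix
    refine ⟨_, ht, h1.trans h3, fun w hw => ?_⟩
    rcases List.mem_cons.1 hw with rfl | hw
    · rw [List.append_assoc]
      exact (List.prefix_append _ _).isInfix
    · exact (h2 w hw).trans h3

theorem IsTransitive.exists_isReturn (hX : X.IsTransitive) {z u : List A} (hz : z ∈ X.language)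
    (hu : u ∈ X.language) : ∃ m, u <:+: m ∧ X.IsReturn z m := by
  obtain ⟨s, -, hs⟩ := hX z hz u hu
  obtain ⟨t, -, ht⟩ := hX _ hs z hz
  exact ⟨s ++ u ++ t, ⟨s, t, rfl⟩, by simpa [IsReturn] using ht⟩

/-! ### The centralizer of all moves -/

/-- The automorphisms that move a word in its frame. -/
def framedAuts (X : Subshift A) (z o : List A) : Set X.Aut :=
  {g | ∃ m, X.IsReturn z m ∧ (∃ b ∈ m, b ∉ z) ∧ X.Restricts (replaceAll (framedRule z o m)) g}

namespace IsMarkerPair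

variable {z o m : List A} (h : X.IsMarkerPair z o)
include h

theorem framedAuts_subset : X.framedAuts z o ⊆ X.eventualCentralizer z o := by
  rintro g ⟨m, hm, hm', hg⟩
  exact mem_eventualCentralizer
    (h.eventuallyCommutes_replaceAll (h.isBoundedRule_framedRule hm hm')) hg

/-- An automorphism of radius `r` that commutes with the move of `m` maps some point with an
occurrence of `m` to a point with an occurrence of `m` at nearly the same position. -/
theorem exists_occursAt_image [DiscreteTopology A] (hm : X.IsReturn z m)
    (hm' : ∃ b ∈ m, b ∉ z) {f : X.Aut} (hf : f ∈ Subgroup.centralizer (X.framedAuts z o)) {r : ℕ}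
    (hr : ∀ (x y : X.carrier) (i : ℤ),
      (∀ j, i - r ≤ j → j ≤ i + r → (x : ℤ → A) j = (y : ℤ → A) j) →
      ((f : X.carrier ≃ₜ X.carrier) x : ℤ → A) i = ((f : X.carrier ≃ₜ X.carrier) y : ℤ → A) i) :
    ∃ (x : X.carrier) (k d : ℤ), -r ≤ d ∧ d ≤ r + z.length ∧ OccursAt (x : ℤ → A) m k ∧
      OccursAt ((f : X.carrier ≃ₜ X.carrier) x : ℤ → A) m (k + d) := by
  obtain ⟨g, hg⟩ := h.exists_framedAut hm hm'
  have hR := isMarkerRule_framedRule h.length_pos h.length_pos' h.not_mem_z hm'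
  have hne := framedWord_ne (o := o) (a := frameSize z m) h.length_pos hm'
  obtain ⟨x₀, hx₀, hocc, -, huniq⟩ := h.exists_framed_point hm hm'
  set u₀ := framedWord z o (frameSize z m) (z ++ m ++ (z ++ z)) with hu₀
  set u₁ := framedWord z o (frameSize z m) ((z ++ z) ++ m ++ z) with hu₁
  have hlen : u₀.length = u₁.length := by
    simp only [hu₀, hu₁, length_framedWord, List.length_append]
    ring
  have hr0 : (u₀, u₁) ∈ framedRule z o m := mem_cyclicRule_pair.2 (Or.inl rfl)
  have hpair : ∀ s ∈ framedRule z o m, s = (u₀, u₁) ∨ s = (u₁, u₀) := fun s hs =>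
    mem_cyclicRule_pair.1 hs
  let x : X.carrier := ⟨x₀, hx₀⟩
  let x' : X.carrier := (g : X.carrier ≃ₜ X.carrier) x
  let y : X.carrier := (f : X.carrier ≃ₜ X.carrier) x
  let y' : X.carrier := (f : X.carrier ≃ₜ X.carrier) x'
  have hx' : (x' : ℤ → A) = replaceAll (framedRule z o m) x₀ := hg x
  have hcomm : g * f = f * g := Subgroup.mem_centralizer_iff.1 hf g ⟨m, hm, hm', hg⟩
  have hy' : (y' : ℤ → A) = replaceAll (framedRule z o m) y := by
    rw [← hg y]
    have := congrArg (fun t : X.Aut => (t : X.carrier ≃ₜ X.carrier) x) hcomm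
    exact congrArg Subtype.val this.symm
  have hocc' : OccursAt (x' : ℤ → A) u₁ 0 := hx' ▸ hR.occursAt_replaceAll hr0 hocc
  have hsupp : ∀ i, x₀ i ≠ (x' : ℤ → A) i → 0 ≤ i ∧ i < u₀.length := by
    intro i hi
    by_contra hcon
    refine hi ?_
    rw [hx', hR.replaceAll_apply_eq_self fun s hs k hk hki => ?_]
    have hk0 := huniq s hs k hk
    subst hk0
    have hsl : s.1.length = u₀.length := by
      rcases hpair s hs with rfl | rfl
      exacts [rfl, hlen.symm]
    omega
  classical
  let D := (Finset.Ico (0 : ℤ) u₀.length).filter fun i => x₀ i ≠ (x' : ℤ → A) i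
  have hmemD : ∀ i, x₀ i ≠ (x' : ℤ → A) i → i ∈ D := fun i hi =>
    Finset.mem_filter.2 ⟨Finset.mem_Ico.2 (hsupp i hi), hi⟩
  have hxx : x₀ ≠ x' := fun hcon => by
    rw [← hcon] at hocc'
    exact hne (hocc.eq_of_length_eq hocc' hlen)
  have hD : D.Nonempty := by
    obtain ⟨i, hi⟩ := Function.ne_iff.1 hxx
    exact ⟨i, hmemD i hi⟩
  -- Otherwise the move fixes `y = f x`, and by commutation and injectivity of `f` it fixes `x`.
  have hex : ∃ s ∈ framedRule z o m, ∃ l, OccursAt (y : ℤ → A) s.1 l := by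
    by_contra! hcon
    have h1 : (y' : ℤ → A) = y := by rw [hy', hR.replaceAll_eq_self hcon]
    have h2 : x' = x := (f : X.carrier ≃ₜ X.carrier).injective (Subtype.ext h1)
    exact hxx (congrArg Subtype.val h2).symm
  obtain ⟨s, hs, l, hl⟩ := hex
  have hl' : OccursAt (y' : ℤ → A) s.2 l := hy' ▸ hR.occursAt_replaceAll hs hl
  -- At `l` the pair `y`, `y'` carries the same two words as `x`, `x'`, possibly in the other order,
  -- so it differs on the translate of `D` by `l`.
  have hdiff : ∀ i ∈ D, (y : ℤ → A) (i + l) ≠ (y' : ℤ → A) (i + l) := by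
    intro i hi
    obtain ⟨hi1, hi2⟩ := Finset.mem_filter.1 hi
    obtain ⟨h1, h2⟩ := Finset.mem_Ico.1 hi1
    have e1 := (occursAt_comp_add (x := (y : ℤ → A)) (k := 0) l).2 (by rwa [zero_add])
    have e2 := (occursAt_comp_add (x := (y' : ℤ → A)) (k := 0) l).2 (by rwa [zero_add])
    rcases hpair s hs with rfl | rfl
    · have t1 : (y : ℤ → A) (i + l) = x₀ i := OccursAt.apply_eq e1 hocc h1 (by simp only; omega)
      have t2 : (y' : ℤ → A) (i + l) = (x' : ℤ → A) i :=
        OccursAt.apply_eq e2 hocc' h1 (by simp only; omega)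
      rwa [t1, t2]
    · have t1 : (y : ℤ → A) (i + l) = (x' : ℤ → A) i :=
        OccursAt.apply_eq e1 hocc' h1 (by simp only; omega)
      have t2 : (y' : ℤ → A) (i + l) = x₀ i := OccursAt.apply_eq e2 hocc h1 (by simp only; omega)
      rw [t1, t2]
      exact hi2.symm
  have hnear : ∀ i, (y : ℤ → A) i ≠ (y' : ℤ → A) i → ∃ j ∈ D, i - r ≤ j ∧ j ≤ i + r := by
    intro i hi
    by_contra! hcon
    refine hi (hr x x' i fun j h1 h2 => ?_)
    by_contra hj
    have := hcon j (hmemD j hj) h1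
    omega
  -- All differences of `y` and `y'` are within `r` of `D`. Applied to the translates of the extreme
  -- points of `D` this bounds `l`.
  have hlr : -r ≤ l ∧ l ≤ r := by
    obtain ⟨j₁, hj₁, -, h1⟩ := hnear _ (hdiff _ (D.min'_mem hD))
    obtain ⟨j₂, hj₂, h2, -⟩ := hnear _ (hdiff _ (D.max'_mem hD))
    have h3 := D.min'_le j₁ hj₁
    have h4 := D.le_max' j₂ hj₂
    omega
  have hpos : OccursAt x₀ m (z.length + (wpow o (frameSize z m)).length + z.length) := by
    simp only [hu₀, framedWord, occursAt_append, List.length_append] at hocc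
    convert hocc.1.1.2.1.2 using 1
    push_cast
    ring
  rcases hpair s hs with rfl | rfl
  · refine ⟨x, _, l, by omega, by omega, hpos, ?_⟩
    simp only [hu₀, framedWord, occursAt_append, List.length_append] at hl
    convert hl.1.1.2.1.2 using 1
    push_cast
    ring
  -- In the second framed word `m` stands one marker further to the right.
  · refine ⟨x, _, l + z.length, by omega, by omega, hpos, ?_⟩
    simp only [hu₁, framedWord, occursAt_append, List.length_append] at hl
    convert hl.1.1.2.1.2 using 1
    push_cast
    ring

/-- The displacement `d` takes values in a finite set that depends on `f` only. One word `m` can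
therefore contain, for each such `d`, a window showing that `f` does not act as the shift by `-d`.
-/
theorem centralizer_framedAuts [Finite A] [DiscreteTopology A] (hX : X.IsTransitive) :
    Subgroup.centralizer (X.framedAuts z o) = Subgroup.zpowers X.σ := by
  refine le_antisymm (fun f hf => ?_) ?_
  swap
  · rw [Subgroup.zpowers_le, Subgroup.mem_centralizer_iff]
    exact fun g _ => (commute_σ g).symm
  obtain ⟨r, hr⟩ := exists_radius f
  by_contra hfσ
  have hbad : ∀ d : ℤ, ∃ (x : X.carrier) (i : ℤ),
      ((f : X.carrier ≃ₜ X.carrier) x : ℤ → A) (i + d) ≠ (x : ℤ → A) i := by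
    intro d
    by_contra! hcon
    refine hfσ ⟨-d, Subtype.ext (Homeomorph.ext fun x => Subtype.ext (funext fun i => ?_))⟩
    show (((X.σ ^ (-d) : X.Aut) : X.carrier ≃ₜ X.carrier) x : ℤ → A) i = _
    rw [σ_zpow_apply, ← hcon x, neg_add_cancel_right]
  choose x i hxi using hbad
  -- As `|d| ≤ r + z.length`, the window of radius `ρ` around `i d` determines the image at `i d +
  -- d`.
  set ρ := 2 * r + z.length with hρ
  let W : ℤ → List A := fun d => window (x d : ℤ → A) (i d - ρ) (2 * ρ + 1)
  -- Including `o` ensures a non-marker letter in `m`.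
  obtain ⟨m₀, hm₀, ho, hW⟩ := hX.exists_infix h.o_mem
    ((Finset.Icc (-(r : ℤ)) (r + z.length)).toList.map W) (by
      intro w hw
      obtain ⟨d, -, rfl⟩ := List.mem_map.1 hw
      exact mem_language (x d).2 (occursAt_window _))
  obtain ⟨m, hm₀m, hm⟩ := hX.exists_isReturn h.z_synchronizing.1 hm₀
  have hm' : ∃ b ∈ m, b ∉ z := by
    obtain ⟨b, hb⟩ := List.exists_mem_of_length_pos h.length_pos'
    exact ⟨b, (ho.trans hm₀m).subset hb, h.not_mem_z b hb⟩
  obtain ⟨y, k, d, hd1, hd2, hyk, hfy⟩ := h.exists_occursAt_image hm hm' hf hr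
  obtain ⟨α, β, hαβ⟩ := (hW (W d) (List.mem_map.2
    ⟨d, Finset.mem_toList.2 (Finset.mem_Icc.2 ⟨hd1, hd2⟩), rfl⟩)).trans hm₀m
  rw [← hαβ, occursAt_append, occursAt_append] at hyk hfy
  have h1 := hyk.1.2
  have h2 := hfy.1.2
  have hwin := occursAt_window (x := (x d : ℤ → A)) (k := i d - ρ) (2 * ρ + 1)
  -- The translation that takes the window around `i d` to its copy inside the occurrence of `m` in
  -- `y`.
  set e : ℤ := k + α.length + ρ - i d with he
  have h1' : OccursAt (fun j => (y : ℤ → A) (j + e)) (W d) (i d - ρ) := by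
    refine (occursAt_comp_add e).2 ?_
    rwa [show i d - ρ + e = k + α.length by omega]
  have h2' : OccursAt (fun j => ((f : X.carrier ≃ₜ X.carrier) y : ℤ → A) (j + (e + d))) (W d)
      (i d - ρ) := by
    refine (occursAt_comp_add (e + d)).2 ?_
    rwa [show i d - ρ + (e + d) = k + d + α.length by omega]
  have hWl : (W d).length = 2 * ρ + 1 := length_window _
  refine hxi d ?_
  -- By locality `f (x d)` at `i d + d` is read off from `f y`, which has the copy of the window
  -- displaced by `d`; the letter is thus `x d` at `i d`, against `hxi`.
  have h3 := hr (x d) ⟨_, comp_add_mem y.2 e⟩ (i d + d) fun j hj hj' =>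
    hwin.apply_eq h1' (by omega) (by rw [length_window]; omega)
  rw [h3, aut_apply_add, add_assoc, add_comm d e]
  exact h2'.apply_eq hwin (by omega) (by omega)

end IsMarkerPair

end Subshift

end SymbolicDynamics

/-! ### The theorem -/

theorem mainTheorem7 {A : Type*} [Finite A] [TopologicalSpace A] [DiscreteTopology A]
    (X : SymbolicDynamics.Subshift A) (hinf : X.carrier.Infinite) (hsync : X.IsSynchronizing)
    (z o : List A) (hzo : X.IsMarkerPair z o)
    (c : ∀ n, SymbolicDynamics.paramBound z o < n → SymbolicDynamics.GliderChoice z o X n) :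
    -- the maps `G_{X,n}` and `F` are automorphisms of `X`
    (∀ n (hn : SymbolicDynamics.paramBound z o < n),
      ∃ g : X.Aut, X.Restricts (SymbolicDynamics.mapG (c n hn)) g) ∧
    (∃ g : X.Aut, X.Restricts (SymbolicDynamics.mapF z o) g) ∧
    -- finite subsets of the group that they generate have a larger centralizer than `⟨σ⟩`
    (∀ S : Set X.Aut, S.Finite →
      S ⊆ (Subgroup.closure (SymbolicDynamics.generators X c) : Set X.Aut) →
      Subgroup.zpowers X.σ < Subgroup.centralizer S) ∧
    -- a set with centralizer `⟨σ⟩` need not have a finite subset with the same centralizer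
    (∃ R : Set X.Aut, Subgroup.centralizer R = Subgroup.zpowers X.σ ∧
      ∀ S : Set X.Aut, S ⊆ R → S.Finite → Subgroup.centralizer S ≠ Subgroup.zpowers X.σ) := by
  refine ⟨fun n hn => hzo.exists_restricts_mapG (c n hn), hzo.exists_restricts_mapF,
    fun S hS hSc => hzo.zpowers_lt_centralizer hS (hSc.trans ?_),
    X.framedAuts z o, hzo.centralizer_framedAuts hsync.1, fun S hSR hS =>
      (hzo.zpowers_lt_centralizer hS (hSR.trans hzo.framedAuts_subset)).ne'⟩
  -- As `eventualCentralizer` is a subgroup, it suffices that it contains the generators.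
  refine SetLike.coe_subset_coe.2 ((Subgroup.closure_le _).2 ?_)
  rintro g (⟨n, hn, hg⟩ | hg)
  · exact SymbolicDynamics.Subshift.IsMarkerPair.mem_eventualCentralizer
      (hzo.eventuallyCommutes_mapG (c n hn)) hg
  · exact SymbolicDynamics.Subshift.IsMarkerPair.mem_eventualCentralizer
      hzo.eventuallyCommutes_mapF hg
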